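/- **Circuits.** An arithmetic circuit $C$ in variables $x_1,\dots,x_n$ is a directed acyclic graph whose terminals are the variables and whose gates are $+$ gates of unbounded fan-in (with distinct inputs) and $\times$ gates of fan-in two; its size $s$ is the number of gates. For a prime $p$ let $F\in\mathbb Z_p[x_1,\dots,x_n]$ be the polynomial it computes over the field $\mathbb Z_p$. A $p$-monomial of $F$ is a monomial with nonzero coefficient in $F$ (in its sum-product expansion) in which every variable has exponent less than $p$. **Theorem.** For every $e\in\mathbb N$ there are a randomized algorithm $A$ (a program of a random access machine with fair coin tosses, where every operation is charged according to the bit lengths of its operands) and a constant $c$ such that the following holds for every prime $p$, all $n,k\in\mathbb N$ and every arithmetic circuit $C$ of size $s$ in $n$ variables whose polynomial $F$ over $\mathbb Z_p$ has degree $k$ (the zero polynomial counts as having degree $0$). On input $(p,k,C)$, with the circuit listed in topological order, 1. $A$ halts for every outcome of its coin tosses within time $c\,(n+k+s+p)^c\cdot p^k$; in particular, for each fixed $p$ its running time is $O^*(p^k)$, where $O^*$ suppresses factors polynomial in $n$, $k$ and $s$; 2. with probability at least $1-(n+k+s+2)^{-e}$ over its coin tosses, $A$ answers correctly whether $F$ has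 a $p$-monomial of degree $k$. -/

import Mathlib

namespace MonomialTesting

/-! ### Arithmetic circuits -/

/-- A gate refers to its inputs by their node numbers. A `+` gate has unbounded fan-in (a directed
graph has no parallel edges, so its inputs are distinct); a `×` gate has fan-in two, and
its two inputs may be the same node. -/
inductive Gate where
  | add (inputs : List ℕ) (nodup : inputs.Nodup)
  | mul (left right : ℕ)

/-- The nodes feeding a gate. -/
def Gate.inputs : Gate → List ℕ
  | .add l _ => l
  | .mul a b => [a, b]

/-- An arithmetic circuit in `n` variables, listed in topological order: node `i < n` is
the terminal labelled by the `i`-th variable, and node `n + j` is the `j`-th gate, whose inputs are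
earlier nodes. There are no other terminals. -/
structure Circuit (n : ℕ) where
  gates : List Gate
  acyclic : ∀ (j : ℕ) (hj : j < gates.length), ∀ i ∈ (gates[j]).inputs, i < n + j
  out : ℕ
  out_lt : out < n + gates.length

/-- The size of a circuit is the number of its gates. -/
def Circuit.size {n : ℕ} (C : Circuit n) : ℕ := C.gates.length

/-- The value of a gate, given the list of the values of all earlier nodes. -/
def Gate.value {R : Type*} [CommSemiring R] (vals : List R) : Gate → R
  | .add l _ => (l.map fun i => vals.getD i 0).sum
  | .mul a b => vals.getD a 0 * vals.getD b 0

/-- The polynomials computed at all nodes, in the order of the nodes. -/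
noncomputable def Circuit.nodePolys {n : ℕ} (C : Circuit n) (R : Type*) [CommSemiring R] :
    List (MvPolynomial (Fin n) R) :=
  C.gates.foldl (fun vals g => vals ++ [g.value vals]) (List.ofFn fun i => MvPolynomial.X i)

/-- The polynomial over `R` represented by the circuit. -/
noncomputable def Circuit.poly {n : ℕ} (C : Circuit n) (R : Type*) [CommSemiring R] :
    MvPolynomial (Fin n) R :=
  (C.nodePolys R).getD C.out 0

/-- `F` has, in its sum-product expansion, a monomial of degree `k` all of whose exponents are
below `c`, i.e. a `c`-monomial of degree `k`. -/
def HasMonomial {n : ℕ} {R : Type*} [CommSemiring R] (c k : ℕ) (F : MvPolynomial (Fin n) R) :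
    Prop :=
  ∃ m ∈ F.support, m.degree = k ∧ ∀ i, m i < c

/-! ### A random access machine with logarithmic (bit) cost

A program works on finitely many arrays of natural numbers (array names are static, indices are
computed), has structured control flow, and may toss fair coins. Every operation is charged
the bit length of the numbers it touches; multiplication, division and remainder are charged the
product of the bit lengths (the school method). -/

/-- Arithmetic operations on natural numbers (subtraction is truncated). -/
inductive Op where
  | add | sub | mul | div | mod

def Op.eval : Op → ℕ → ℕ → ℕ
  | .add, x, y => x + y
  | .sub, x, y => x - y
  | .mul, x, y => x * y
  | .div, x, y => x / y
  | .mod, x, y => x % y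

/-- `Nat.size x` is the number of binary digits of `x`. -/
def Op.cost : Op → ℕ → ℕ → ℕ
  | .add, x, y => 1 + x.size + y.size
  | .sub, x, y => 1 + x.size + y.size
  | .mul, x, y => (1 + x.size) * (1 + y.size)
  | .div, x, y => (1 + x.size) * (1 + y.size)
  | .mod, x, y => (1 + x.size) * (1 + y.size)

/-- The memory: `μ a i` is the content of cell `i` of array `a`. -/
abbrev Memory := ℕ → ℕ → ℕ

/-- Expressions; `get a e` reads the cell of array `a` whose index is the value of `e`. -/
inductive Expr where
  | lit (c : ℕ)
  | get (a : ℕ) (e : Expr)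
  | op (o : Op) (e₁ e₂ : Expr)

def Expr.eval (μ : Memory) : Expr → ℕ
  | .lit c => c
  | .get a e => μ a (e.eval μ)
  | .op o e₁ e₂ => o.eval (e₁.eval μ) (e₂.eval μ)

def Expr.cost (μ : Memory) : Expr → ℕ
  | .lit c => 1 + c.size
  | .get a e => e.cost μ + (1 + (e.eval μ).size + (μ a (e.eval μ)).size)
  | .op o e₁ e₂ => e₁.cost μ + e₂.cost μ + o.cost (e₁.eval μ) (e₂.eval μ)

/-- Programs. `set a i e` writes the value of `e` to cell `i` of array `a`; `flip a i` writes
a fresh random bit there; tests succeed when the value of the expression is nonzero. -/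
inductive Program where
  | skip
  | set (a : ℕ) (i e : Expr)
  | flip (a : ℕ) (i : Expr)
  | seq (P Q : Program)
  | ite (b : Expr) (P Q : Program)
  | while (b : Expr) (P : Program)

/-- A machine state: the memory and the sequence of coin tosses still to come. -/
structure State where
  mem : Memory
  coins : ℕ → Bool

/-- The memory after writing `v` to cell `i` of array `a`. -/
def Memory.write (μ : Memory) (a i v : ℕ) : Memory :=
  Function.update μ a (Function.update (μ a) i v)

/-- `Exec P σ t τ`: started in the state `σ`, the program `P` halts in the state `τ` after
time `t`. -/
inductive Exec : Program → State → ℕ → State → Prop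
  | skip (σ : State) : Exec .skip σ 1 σ
  | set (σ : State) (a : ℕ) (i e : Expr) :
      Exec (.set a i e) σ
        (i.cost σ.mem + e.cost σ.mem + (1 + (i.eval σ.mem).size + (e.eval σ.mem).size))
        ⟨σ.mem.write a (i.eval σ.mem) (e.eval σ.mem), σ.coins⟩
  | flip (σ : State) (a : ℕ) (i : Expr) :
      Exec (.flip a i) σ (i.cost σ.mem + (1 + (i.eval σ.mem).size))
        ⟨σ.mem.write a (i.eval σ.mem) (σ.coins 0).toNat, fun j => σ.coins (j + 1)⟩
  | seq {P Q : Program} {σ σ' σ'' : State} {t t' : ℕ} :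
      Exec P σ t σ' → Exec Q σ' t' σ'' → Exec (.seq P Q) σ (t + t') σ''
  | ite_true {b : Expr} {P Q : Program} {σ σ' : State} {t : ℕ} :
      b.eval σ.mem ≠ 0 → Exec P σ t σ' → Exec (.ite b P Q) σ (b.cost σ.mem + 1 + t) σ'
  | ite_false {b : Expr} {P Q : Program} {σ σ' : State} {t : ℕ} :
      b.eval σ.mem = 0 → Exec Q σ t σ' → Exec (.ite b P Q) σ (b.cost σ.mem + 1 + t) σ'
  | while_true {b : Expr} {P : Program} {σ σ' σ'' : State} {t t' : ℕ} :
      b.eval σ.mem ≠ 0 → Exec P σ t σ' → Exec (.while b P) σ' t' σ'' →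
        Exec (.while b P) σ (b.cost σ.mem + 1 + t + t') σ''
  | while_false {b : Expr} {P : Program} {σ : State} :
      b.eval σ.mem = 0 → Exec (.while b P) σ (b.cost σ.mem + 1) σ

/-- The initial state: the input occupies the first cells of array `0`, and all other
cells hold `0`. -/
def initState (input : List ℕ) (coins : ℕ → Bool) : State where
  mem := fun a i => if a = 0 then input.getD i 0 else 0
  coins := coins

/-- On this input and these coin tosses the program halts within time `T` and answers `b` (cell
`0` of array `1` holds `1` for yes, `0` for no). -/
def Program.AnswersWithin (P : Program) (input : List ℕ) (coins : ℕ → Bool) (T : ℕ) (b : Bool) :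
    Prop :=
  ∃ (t : ℕ) (τ : State), Exec P (initState input coins) t τ ∧ t ≤ T ∧ τ.mem 1 0 = b.toNat

/-- A finite sequence of coin tosses, continued by an irrelevant tail. A run within time `T` uses
at most `T` coin tosses. -/
def extend {T : ℕ} (r : Fin T → Bool) : ℕ → Bool :=
  fun i => if h : i < T then r ⟨i, h⟩ else false

open Classical in
/-- The probability of the event `A` for `T` independent fair coin tosses. -/
noncomputable def coinProb (T : ℕ) (A : (Fin T → Bool) → Prop) : ℝ :=
  ((Finset.univ.filter fun r : Fin T → Bool => A r).card : ℝ) / 2 ^ T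

/-! ### Input format -/

/-- The description of a gate by natural numbers. -/
def Gate.encode : Gate → List ℕ
  | .add l _ => 0 :: l.length :: l
  | .mul a b => [1, a, b]

/-- The input given to the program: the numbers `p` and `k`, and the description of the
circuit. -/
def encodeInput (p k : ℕ) {n : ℕ} (C : Circuit n) : List ℕ :=
  p :: k :: n :: C.size :: C.out :: C.gates.flatMap Gate.encode

end MonomialTesting

namespace MonomialTesting

/-! Substitute `xᵢ ↦ ∑ⱼ aᵢⱼ yⱼ` for an `n × k` matrix `a` and consider the coefficient of `y₁⋯yₖ` in
the result. Monomials of degree below `k` contribute nothing. Neither do monomials with an exponent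
at least `p`: in characteristic `p` the `p`-th power of a linear form is a combination of the `yⱼ ^
p`. So without a `p`-monomial of degree `k` the coefficient vanishes for every `a`
(`coeff_aeval_linearForms_eq_zero`). Conversely, given such a monomial `m`, assign one variable to
each `yⱼ` so that `xᵢ` is used `m i` times. The coefficient is then `∏ (m i)!` times the coefficient
of `m`, which is nonzero modulo `p` (`exists_coeff_aeval_linearForms_ne_zero`). As `F` has degree at
most `k`, inclusion-exclusion over subsets of the `yⱼ` expresses the coefficient, up to sign, by `2
^ k` values of `F` (`alternatingSum_eq`), and the circuit can compute these.

This alternating sum is a polynomial of degree at most `k` in the entries of `a`. The field `ZMod p`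
may be too small for random entries, so the entries are taken from its polynomial ring in one
variable, with `d` random coefficients `0` or `1`; no extension field has to be constructed.
Schwartz-Zippel on a sample set of size `2 ^ d` bounds the failure probability by `k / 2 ^ d`
(`coinProb_alternatingSum_ne_zero`), and `d = (e + 1) * (n + k + s + 2)` is large enough. The error
is one-sided. The sum has degree at most `k * d` in the new variable, so it suffices to compute the
first `k * d + 1` coefficients at every node.

The program performs `2 ^ k` rounds of polynomial cost, and `2 ≤ p` gives the bound with `p ^ k`.
Its analysis is a Hoare-style calculus (`Wp`): with all cells at most `M`, an elementary step costs
a constant times the squared word length, so only steps and cell bounds need counting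
(`wp_testProgram`, `exists_exec`). -/

/-! ### Degrees under substitution -/

open MvPolynomial in
theorem totalDegree_aeval_le {K R σ τ : Type*} [CommRing K] [CommRing R] [Algebra K R]
    (F : MvPolynomial σ K) (f : σ → MvPolynomial τ R) (hf : ∀ i, (f i).totalDegree ≤ 1) :
    (aeval f F).totalDegree ≤ F.totalDegree := by
  rw [aeval_def, eval₂_eq]
  refine totalDegree_finsetSum_le fun m hm => ?_
  rw [MvPolynomial.algebraMap_apply]
  refine (totalDegree_mul _ _).trans ?_
  rw [totalDegree_C, zero_add]
  refine (totalDegree_finsetProd _ _).trans ((Finset.sum_le_sum (g := fun i => m i) fun i _ => ?_).trans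
    (le_totalDegree hm))
  exact (totalDegree_pow _ _).trans (by nlinarith [hf i])

open Polynomial in
theorem natDegree_aeval_le {K R σ : Type*} [CommRing K] [CommRing R] [Algebra K R]
    (F : MvPolynomial σ K) (f : σ → R[X]) (d : ℕ) (hf : ∀ i, (f i).natDegree ≤ d) :
    (MvPolynomial.aeval f F).natDegree ≤ F.totalDegree * d := by
  rw [MvPolynomial.aeval_def, MvPolynomial.eval₂_eq]
  refine natDegree_sum_le_of_forall_le _ _ fun m hm => ?_
  rw [Polynomial.algebraMap_apply]
  refine (natDegree_C_mul_le _ _).trans ((natDegree_prod_le _ _).trans ?_)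
  refine (Finset.sum_le_sum (g := fun i => m i * d) fun i _ =>
    natDegree_pow_le_of_le _ (hf i)).trans ?_
  rw [← Finset.sum_mul]
  exact Nat.mul_le_mul_right _ (MvPolynomial.le_totalDegree hm)

/-! ### The multilinear coefficient as an alternating sum -/

/-- The linear substitution `xᵢ ↦ ∑ⱼ aᵢⱼ yⱼ`. -/
noncomputable def linearForms {R : Type*} [CommRing R] {n k : ℕ} (a : Fin n → Fin k → R) (i : Fin n) :
    MvPolynomial (Fin k) R :=
  ∑ j, MvPolynomial.C (a i j) * MvPolynomial.X j

/-- The exponent vector of the product of all variables. -/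
noncomputable def allOnes (k : ℕ) : Fin k →₀ ℕ := Finsupp.equivFunOnFinite.symm fun _ => 1

@[simp] theorem allOnes_apply (k : ℕ) (j : Fin k) : allOnes k j = 1 := rfl

/-- The alternating sum of the values of `F` at the subset sums of the columns of `a`. -/
noncomputable def alternatingSum {K R : Type*} [CommRing K] [CommRing R] [Algebra K R] {n k : ℕ}
    (F : MvPolynomial (Fin n) K) (a : Fin n → Fin k → R) : R :=
  ∑ b : Fin k → Fin 2, (∏ j, (1 - 2 * ((b j : ℕ) : R))) *
    MvPolynomial.aeval (fun i => ∑ j, ((b j : ℕ) : R) * a i j) F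

open MvPolynomial in
theorem totalDegree_linearForms_le {R : Type*} [CommRing R] {n k : ℕ} (a : Fin n → Fin k → R)
    (i : Fin n) : (linearForms a i).totalDegree ≤ 1 := by
  refine totalDegree_finsetSum_le fun j _ => (totalDegree_mul _ _).trans ?_
  rw [totalDegree_C, zero_add]
  exact (totalDegree_monomial_le _ _).trans (by simp)

-- On a single monomial the sum over `b` factors over the coordinates into `∏ j, (0 ^ m j - 1)`,
-- which vanishes as soon as some `m j = 0`. The degree bound leaves only the product of all
-- variables.
open MvPolynomial in
theorem sum_signed_eval {R : Type*} [CommRing R] {k : ℕ} (h : MvPolynomial (Fin k) R)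
    (hk : h.totalDegree ≤ k) :
    ∑ b : Fin k → Fin 2, (∏ j, (1 - 2 * ((b j : ℕ) : R))) * eval (fun j => ((b j : ℕ) : R)) h =
      (-1) ^ k * h.coeff (allOnes k) := by
  have key : ∀ m : Fin k →₀ ℕ, ∑ b : Fin k → Fin 2, (∏ j, (1 - 2 * ((b j : ℕ) : R))) *
      ∏ j, ((b j : ℕ) : R) ^ m j = ∏ j, ((0 : R) ^ m j - 1) := by
    intro m
    have : ∀ j : Fin k, ((0 : R) ^ m j - 1) =
        ∑ b : Fin 2, (1 - 2 * ((b : ℕ) : R)) * ((b : ℕ) : R) ^ m j := by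
      intro j; simp [Fin.sum_univ_two]; ring
    simp_rw [this, Finset.prod_univ_sum, Fintype.piFinset_univ, Finset.prod_mul_distrib]
  simp_rw [eval_eq', Finset.mul_sum]
  rw [Finset.sum_comm]
  have h1 : ∀ m ∈ h.support, ∑ b : Fin k → Fin 2, (∏ j, (1 - 2 * ((b j : ℕ) : R))) *
      (h.coeff m * ∏ j, ((b j : ℕ) : R) ^ m j) =
      if m = allOnes k then (-1) ^ k * h.coeff (allOnes k) else 0 := by
    intro m hm
    have : ∑ b : Fin k → Fin 2, (∏ j, (1 - 2 * ((b j : ℕ) : R))) *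
      (h.coeff m * ∏ j, ((b j : ℕ) : R) ^ m j) = h.coeff m * ∏ j, ((0 : R) ^ m j - 1) := by
      rw [← key, Finset.mul_sum]
      exact Finset.sum_congr rfl fun b _ => by ring
    rw [this]
    split_ifs with hm1
    · subst hm1; simp [mul_comm]
    -- If all `k` exponents were positive, total degree at most `k` would force each of them to be
    -- `1`.
    · obtain ⟨j, hj⟩ : ∃ j, m j = 0 := by
        by_contra! hne
        have hge : ∀ j, 1 ≤ m j := fun j => Nat.one_le_iff_ne_zero.2 (hne j)
        have hle : ∑ j, m j ≤ ∑ _j : Fin k, 1 := by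
          have := le_totalDegree hm
          rw [Finsupp.sum_fintype _ _ (fun _ => rfl)] at this
          simpa using this.trans hk
        have heq := (Finset.sum_eq_sum_iff_of_le (fun j _ => hge j)).1
          (le_antisymm (Finset.sum_le_sum fun j _ => hge j) hle)
        exact hm1 (Finsupp.ext fun j => (heq j (Finset.mem_univ j)).symm)
      rw [Finset.prod_eq_zero (Finset.mem_univ j) (by simp [hj]), mul_zero]
  rw [Finset.sum_congr rfl h1, Finset.sum_ite_eq']
  split_ifs with hs
  · rfl
  · rw [notMem_support_iff.1 hs, mul_zero]

open MvPolynomial in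
theorem alternatingSum_eq {K R : Type*} [CommRing K] [CommRing R] [Algebra K R] {n k : ℕ}
    (F : MvPolynomial (Fin n) K) (hF : F.totalDegree ≤ k) (a : Fin n → Fin k → R) :
    alternatingSum F a = (-1) ^ k * (aeval (linearForms a) F).coeff (allOnes k) := by
  rw [← sum_signed_eval _ ((totalDegree_aeval_le F _ (totalDegree_linearForms_le a)).trans hF)]
  refine Finset.sum_congr rfl fun b _ => ?_
  congr 1
  have := comp_aeval_apply (linearForms a)
    ((MvPolynomial.aeval (R := R) fun j => ((b j : ℕ) : R)).restrictScalars K) F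
  simp only [AlgHom.restrictScalars_apply, aeval_eq_eval] at this
  refine Eq.trans ?_ this.symm
  congr 2
  funext i
  simp [linearForms, mul_comm]

-- Each monomial of `F` contributes zero: either its degree is too small, or it contains a `p`-th
-- power of a linear form, in which every `yⱼ` has exponent `0` or at least `p`.
open MvPolynomial in
theorem coeff_aeval_linearForms_eq_zero {p : ℕ} [Fact p.Prime] {R : Type*} [CommRing R]
    [Algebra (ZMod p) R] {n k : ℕ} (F : MvPolynomial (Fin n) (ZMod p)) (hF : F.totalDegree ≤ k)
    (h : ¬ HasMonomial p k F) (a : Fin n → Fin k → R) :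
    (aeval (linearForms a) F).coeff (allOnes k) = 0 := by
  cases subsingleton_or_nontrivial R
  · exact Subsingleton.elim _ _
  have : CharP R p := charP_of_injective_algebraMap (algebraMap (ZMod p) R).injective p
  rw [aeval_def, eval₂_eq', coeff_sum]
  refine Finset.sum_eq_zero fun m hm => ?_
  rw [MvPolynomial.algebraMap_apply, coeff_C_mul]
  have hmk : m.degree ≤ k := by
    rw [Finsupp.degree_eq_sum, ← Finsupp.sum_fintype m (fun _ e => e) (fun _ => rfl)]
    exact (le_totalDegree hm).trans hF
  rcases hmk.lt_or_eq with hlt | heq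
  · rw [coeff_eq_zero_of_totalDegree_lt (f := ∏ i, linearForms a i ^ m i), mul_zero]
    have hk : ∑ i ∈ (allOnes k).support, (allOnes k) i = k := by
      rw [Finset.sum_subset (Finset.subset_univ _) (fun i _ hi => by simp at hi)]
      simp
    rw [hk]
    refine lt_of_le_of_lt ?_ hlt
    rw [Finsupp.degree_eq_sum]
    refine (totalDegree_finsetProd _ _).trans (Finset.sum_le_sum fun i _ => ?_)
    exact (totalDegree_pow _ _).trans (by nlinarith [totalDegree_linearForms_le a i])
  · obtain ⟨i, hi⟩ : ∃ i, p ≤ m i := by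
      by_contra! hlt
      exact h ⟨m, hm, heq, hlt⟩
    have hp2 : 2 ≤ p := (Fact.out : p.Prime).two_le
    -- Frobenius is additive in characteristic `p`. No term on the right divides the product of all
    -- variables, since `p > 1`.
    have hpow : linearForms a i ^ p =
        ∑ j, monomial (Finsupp.single j p) (a i j ^ p) := by
      rw [linearForms, sum_pow_char]
      refine Finset.sum_congr rfl fun j _ => ?_
      rw [mul_pow, ← C_pow, X_pow_eq_monomial, C_mul_monomial, mul_one]
    rw [← Finset.mul_prod_erase _ _ (Finset.mem_univ i), ← Nat.add_sub_of_le hi, pow_add, hpow,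
      mul_assoc, Finset.sum_mul, coeff_sum, Finset.sum_eq_zero, mul_zero]
    intro j _
    rw [coeff_monomial_mul', if_neg]
    intro hle
    have := hle j
    simp at this
    omega

-- Each derivative multiplies by a positive exponent. All these factors are at most the exponents of
-- the original monomial, so their product `u` is prime to `p` when those exponents are below `p`.
open MvPolynomial in
theorem coeff_foldr_pderiv {R σ : Type*} [CommRing R] (F : MvPolynomial σ R) (l : List σ) (m : σ →₀ ℕ) :
    ∃ u : ℕ, (∀ p : ℕ, p.Prime → (∀ i, (m + (l.map (Finsupp.single · 1)).sum : σ →₀ ℕ) i < p) → ¬ p ∣ u) ∧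
      coeff m (l.foldr (fun i G => pderiv i G) F) =
        coeff (m + (l.map (Finsupp.single · 1)).sum) F * u := by
  classical
  induction l generalizing m with
  | nil => exact ⟨1, fun p hp _ h => hp.one_lt.ne' (Nat.dvd_one.1 h), by simp⟩
  | cons i l ih =>
    obtain ⟨u, hu, hc⟩ := ih (m + Finsupp.single i 1)
    refine ⟨u * (m i + 1), fun p hp hlt hdvd => ?_, ?_⟩
    · rw [List.map_cons, List.sum_cons, ← add_assoc] at hlt
      rcases hp.dvd_mul.1 hdvd with h | h
      · exact hu p hp hlt h
      · have h1 := Nat.le_of_dvd (Nat.succ_pos _) h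
        have h2 := hlt i
        simp only [Finsupp.add_apply, Finsupp.single_eq_same] at h2
        omega
    · rw [List.foldr_cons, coeff_pderiv, hc, List.map_cons, List.sum_cons, ← add_assoc]
      push_cast
      ring

-- Chain rule: `yⱼ` occurs in exactly one of the linear forms, that of `x_{φ j}`, with coefficient
-- `1`.
open MvPolynomial in
theorem pderiv_aeval_linearForms {K : Type*} [CommRing K] {n k : ℕ} (φ : Fin k → Fin n)
    (F : MvPolynomial (Fin n) K) (j : Fin k) :
    pderiv j (aeval (linearForms fun i j => if φ j = i then (1 : K) else 0) F) =
      aeval (linearForms fun i j => if φ j = i then (1 : K) else 0) (pderiv (φ j) F) := by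
  induction F using MvPolynomial.induction_on with
  | C a => simp
  | add P Q hP hQ => simp only [map_add, hP, hQ]
  | mul_X P i hP =>
    have hX : pderiv j (linearForms (fun i j => if φ j = i then (1 : K) else 0) i) =
        if φ j = i then 1 else 0 := by
      simp only [linearForms, map_sum, pderiv_C_mul, pderiv_X]
      rw [Finset.sum_eq_single j]
      · split_ifs <;> simp
      · intro j' _ hj'; simp [Pi.single_eq_of_ne hj']
      · simp
    rw [map_mul, pderiv_mul, hP, aeval_X, hX, pderiv_mul, map_add, map_mul, map_mul, aeval_X, pderiv_X]
    congr 2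
    by_cases h : φ j = i
    · subst h; simp
    · simp [h]

open MvPolynomial in
theorem exists_coeff_aeval_linearForms_ne_zero {p : ℕ} (hp : p.Prime) {n k : ℕ}
    (F : MvPolynomial (Fin n) (ZMod p)) (h : HasMonomial p k F) :
    ∃ a : Fin n → Fin k → ZMod p, (aeval (linearForms a) F).coeff (allOnes k) ≠ 0 := by
  have : Fact p.Prime := ⟨hp⟩
  obtain ⟨m, hm, hk, hlt⟩ := h
  -- `φ` lists the variables of `m` with multiplicity; there are `k` of them because `m` has degree
  -- `k`.
  obtain ⟨φ, hφ⟩ : ∃ φ : Fin k → Fin n,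
      (((List.finRange k).map φ).map (Finsupp.single · 1)).sum = m := by
    have hlen : (Finsupp.toMultiset m).toList.length = k := by
      rw [Multiset.length_toList, Finsupp.card_toMultiset, ← hk, Finsupp.degree_eq_sum,
        Finsupp.sum_fintype _ _ (fun _ => rfl)]
      rfl
    subst hlen
    refine ⟨(Finsupp.toMultiset m).toList.get, ?_⟩
    rw [← List.ofFn_eq_map, List.ofFn_get, ← Multiset.sum_coe, ← Multiset.map_coe, Multiset.coe_toList]
    conv_rhs => rw [← Finsupp.toMultiset_toFinsupp m, ← Multiset.sum_map_singleton (Finsupp.toMultiset m)]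
    rw [map_multiset_sum, Multiset.map_map]
    congr 1
    refine Multiset.map_congr rfl fun i _ => ?_
    simp
  set a : Fin n → Fin k → ZMod p := fun i j => if φ j = i then 1 else 0 with ha
  refine ⟨a, fun h0 => ?_⟩
  have hfold : ∀ l : List (Fin k), l.foldr (fun j G => pderiv j G) (aeval (linearForms a) F) =
      aeval (linearForms a) ((l.map φ).foldr (fun i G => pderiv i G) F) := by
    intro l
    induction l with
    | nil => rfl
    | cons j l ih => rw [List.foldr_cons, ih, ha, pderiv_aeval_linearForms]; rfl
  have hconst : ∀ G : MvPolynomial (Fin n) (ZMod p),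
      coeff 0 (aeval (linearForms a) G) = coeff 0 G := by
    intro G
    have : (constantCoeff (R := ZMod p) (σ := Fin k)).comp
        (aeval (R := ZMod p) (linearForms a)).toRingHom = (constantCoeff : MvPolynomial (Fin n) (ZMod p) →+* ZMod p) := by
      ext i <;> simp [linearForms]
    exact congrArg (fun f => f G) this
  -- Differentiate once by every `yⱼ` and take the constant term. One side is `u` times the
  -- coefficient of the product of all `yⱼ`, the other `v` times the coefficient of `m`, with `v`
  -- prime to `p`.
  obtain ⟨u, -, hu⟩ := coeff_foldr_pderiv (aeval (linearForms a) F) (List.finRange k) 0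
  obtain ⟨v, hv, hv'⟩ := coeff_foldr_pderiv F ((List.finRange k).map φ) 0
  have hones : ((List.finRange k).map (Finsupp.single · 1)).sum = allOnes k := by
    ext j
    rw [← List.ofFn_eq_map, List.sum_ofFn, Finsupp.finsetSum_apply, Finset.sum_eq_single j] <;>
      simp +contextual
  rw [hfold, hconst, hv', hones, zero_add, zero_add, h0, zero_mul, hφ] at hu
  rw [hφ] at hv
  rcases mul_eq_zero.1 hu with h1 | h1
  · exact (mem_support_iff.1 hm) h1
  · exact hv p hp (by simpa using hlt) ((ZMod.natCast_eq_zero_iff _ _).1 h1)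

/-! ### The alternating sum as a polynomial in the matrix entries -/

theorem map_alternatingSum {K R S : Type*} [CommRing K] [CommRing R] [Algebra K R] [CommRing S]
    [Algebra K S] {n k : ℕ} (f : R →ₐ[K] S) (F : MvPolynomial (Fin n) K) (a : Fin n → Fin k → R) :
    f (alternatingSum F a) = alternatingSum F fun i j => f (a i j) := by
  simp only [alternatingSum, map_sum, map_mul, map_prod, map_sub, map_one, map_natCast,
    map_ofNat, MvPolynomial.comp_aeval_apply]

open MvPolynomial in
/-- The alternating sum at a matrix of indeterminates. -/
noncomputable def genericSum {K : Type*} [CommRing K] {n : ℕ} (k : ℕ) (R : Type*) [CommRing R]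
    [Algebra K R] (F : MvPolynomial (Fin n) K) : MvPolynomial (Fin (n * k)) R :=
  alternatingSum F fun (i : Fin n) (j : Fin k) => X (finProdFinEquiv (i, j))

open MvPolynomial in
theorem eval_genericSum {K R : Type*} [CommRing K] [CommRing R] [Algebra K R] {n k : ℕ}
    (F : MvPolynomial (Fin n) K) (a : Fin (n * k) → R) :
    eval a (genericSum k R F) = alternatingSum F fun i j => a (finProdFinEquiv (i, j)) := by
  have := map_alternatingSum ((aeval (R := R) a).restrictScalars K) F
    fun (i : Fin n) (j : Fin k) => X (finProdFinEquiv (i, j))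
  simpa [AlgHom.restrictScalars_apply, aeval_eq_eval, genericSum] using this

open MvPolynomial in
theorem totalDegree_genericSum_le {K R : Type*} [CommRing K] [CommRing R] [Algebra K R] {n k : ℕ}
    (F : MvPolynomial (Fin n) K) (hF : F.totalDegree ≤ k) :
    (genericSum k R F).totalDegree ≤ k := by
  refine totalDegree_finsetSum_le fun b _ => (totalDegree_mul _ _).trans ?_
  have h1 : (∏ j, (1 - 2 * ((b j : ℕ) : MvPolynomial (Fin (n * k)) R))) =
      C (∏ j, (1 - 2 * ((b j : ℕ) : R))) := by
    simp only [map_prod, map_sub, map_one, map_mul, map_ofNat, map_natCast]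
  rw [h1, totalDegree_C, zero_add]
  refine (totalDegree_aeval_le F _ fun i => ?_).trans hF
  refine totalDegree_finsetSum_le fun j _ => (totalDegree_mul _ _).trans ?_
  rw [← map_natCast (C : R →+* _), totalDegree_C, zero_add]
  exact (totalDegree_monomial_le _ _).trans (by simp)

-- A matrix over `ZMod p` with nonzero sum stays a witness over `R`, since a field embeds into every
-- nontrivial algebra over it.
open MvPolynomial in
theorem genericSum_ne_zero {p : ℕ} [hp : Fact p.Prime] {R : Type*} [CommRing R] [Nontrivial R]
    [Algebra (ZMod p) R] {n k : ℕ} (F : MvPolynomial (Fin n) (ZMod p)) (hF : F.totalDegree ≤ k)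
    (h : HasMonomial p k F) : genericSum k R F ≠ 0 := by
  obtain ⟨a, ha⟩ := exists_coeff_aeval_linearForms_ne_zero hp.out F h
  intro h0
  have h1 := eval_genericSum (k := k) F
    fun c : Fin (n * k) => algebraMap (ZMod p) R (a (finProdFinEquiv.symm c).1 (finProdFinEquiv.symm c).2)
  simp only [h0, map_zero, Equiv.symm_apply_apply] at h1
  have h2 := map_alternatingSum (Algebra.ofId (ZMod p) R) F a
  simp only [Algebra.ofId_apply] at h2
  rw [← h2, alternatingSum_eq F hF, eq_comm, map_eq_zero] at h1
  exact ha (by simpa using h1)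

/-! ### Random entries and the Schwartz-Zippel bound -/

open Polynomial in
/-- The polynomial whose coefficients are the given bits. -/
noncomputable def bitPoly (K : Type*) [CommRing K] (d : ℕ) (f : Fin d → Bool) : K[X] :=
  ∑ l : Fin d, monomial (l : ℕ) (((f l).toNat : ℕ) : K)

theorem coeff_bitPoly {K : Type*} [CommRing K] {d : ℕ} (f : Fin d → Bool) (l : ℕ) :
    (bitPoly K d f).coeff l = if h : l < d then (((f ⟨l, h⟩).toNat : ℕ) : K) else 0 := by
  simp only [bitPoly, Polynomial.finsetSum_coeff, Polynomial.coeff_monomial]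
  split_ifs with h
  · rw [Finset.sum_eq_single ⟨l, h⟩]
    · simp
    · intro j _ hj
      exact if_neg fun e => hj (Fin.ext e)
    · simp
  · exact Finset.sum_eq_zero fun j _ => if_neg fun e : (j : ℕ) = l => h (e ▸ j.2)

theorem bitPoly_injective (K : Type*) [CommRing K] [Nontrivial K] (d : ℕ) :
    Function.Injective (bitPoly K d) := by
  intro f g h
  funext l
  have := congrArg (fun q => q.coeff l) h
  simp only [coeff_bitPoly, l.2, dite_true] at this
  cases hf : f l <;> cases hg : g l <;> simp_all

/-- The polynomial whose coefficients are `d` consecutive coins starting from the coin `c * d`. -/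
noncomputable def coinPoly (K : Type*) [CommRing K] (d : ℕ) (coins : ℕ → Bool) (c : ℕ) : Polynomial K :=
  bitPoly K d fun l => coins (c * d + l)

/-- A function on `T ≥ m d` coins is a family of `m` blocks of `d` coins, and some more coins. -/
def coinBlocks (m d t : ℕ) : (Fin (m * d + t) → Bool) ≃ (Fin m → Fin d → Bool) × (Fin t → Bool) :=
  ((finSumFinEquiv.arrowCongr (Equiv.refl Bool)).symm.trans
    (Equiv.sumArrowEquivProdArrow _ _ _)).trans
      (Equiv.prodCongr ((finProdFinEquiv.arrowCongr (Equiv.refl Bool)).symm.trans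
        (Equiv.curry _ _ _)) (Equiv.refl _))

theorem coinBlocks_apply (m d t : ℕ) (r : Fin (m * d + t) → Bool) (c : Fin m) (l : Fin d) :
    (coinBlocks m d t r).1 c l = extend r (c * d + l) := by
  have h : (c : ℕ) * d + l < m * d := by
    have := (finProdFinEquiv (c, l)).2
    simp only [finProdFinEquiv_apply_val] at this
    nlinarith
  have h' : (c : ℕ) * d + l < m * d + t := by omega
  simp only [extend, h', dite_true]
  simp [coinBlocks]
  congr 1
  ext
  simp
  ring

-- Schwartz-Zippel over the domain `K[X]`, with the `2 ^ d` polynomials having bit coefficients as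
-- sample set; the inequality is stated without denominators.
open Classical in
theorem card_filter_bitPoly_le {K : Type*} [Field K] {m k d : ℕ}
    (G : MvPolynomial (Fin m) (Polynomial K)) (hG : G ≠ 0) (hk : G.totalDegree ≤ k) :
    ((Finset.univ.filter fun f : Fin m → Fin d → Bool =>
      MvPolynomial.eval (fun c => bitPoly K d (f c)) G = 0).card : ℝ) * 2 ^ d ≤ k * 2 ^ (m * d) := by
  classical
  set S : Finset (Polynomial K) := Finset.univ.image (bitPoly K d) with hS
  have hcard : S.card = 2 ^ d := by
    rw [hS, Finset.card_image_of_injective _ (bitPoly_injective K d)]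
    simp
  have hsz := MvPolynomial.schwartz_zippel_totalDegree hG S
  rw [hcard] at hsz
  have hle : (Finset.univ.filter fun f : Fin m → Fin d → Bool =>
      MvPolynomial.eval (fun c => bitPoly K d (f c)) G = 0).card ≤
      ((Fintype.piFinset fun _ => S).filter fun x => MvPolynomial.eval x G = 0).card := by
    refine Finset.card_le_card_of_injOn (fun f c => bitPoly K d (f c)) ?_ ?_
    · intro f hf
      simp only [Finset.coe_filter, Finset.mem_univ, true_and, Set.mem_ofPred_eq] at hf
      simp [hf, hS]
    · intro f _ g _ h
      funext c
      exact bitPoly_injective K d (congrFun h c)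
  push_cast at hsz
  rw [div_le_div_iff₀ (by positivity) (by positivity), ← pow_mul, mul_comm d m] at hsz
  have hsz' := (NNRat.cast_le (K := ℝ)).2 hsz
  push_cast at hsz'
  calc _ ≤ _ := mul_le_mul_of_nonneg_right (Nat.cast_le.2 hle) (by positivity)
    _ ≤ _ := hsz'
    _ ≤ _ := mul_le_mul_of_nonneg_right (Nat.cast_le.2 hk) (by positivity)

theorem coinProb_alternatingSum_ne_zero {p : ℕ} [Fact p.Prime] {n k : ℕ}
    (F : MvPolynomial (Fin n) (ZMod p)) (hF : F.totalDegree ≤ k) (h : HasMonomial p k F)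
    (d T : ℕ) (hT : n * k * d ≤ T) :
    1 - (k : ℝ) / 2 ^ d ≤ coinProb T fun r => alternatingSum F (fun (i : Fin n) (j : Fin k) =>
      coinPoly (ZMod p) d (extend r) (i * k + j)) ≠ 0 := by
  classical
  -- The `t` surplus coins are irrelevant: they multiply both the bad outcomes and all outcomes by
  -- `2 ^ t`.
  obtain ⟨t, rfl⟩ := Nat.exists_eq_add_of_le hT
  set G := genericSum k (Polynomial (ZMod p)) F
  set bad := Finset.univ.filter fun f : Fin (n * k) → Fin d → Bool =>
    MvPolynomial.eval (fun c => bitPoly (ZMod p) d (f c)) G = 0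
  have hbound : (bad.card : ℝ) * 2 ^ d ≤ k * 2 ^ (n * k * d) := by
    convert card_filter_bitPoly_le (d := d) G (genericSum_ne_zero F hF h)
      (totalDegree_genericSum_le F hF)
  have hiff : ∀ r : Fin (n * k * d + t) → Bool, alternatingSum F (fun (i : Fin n) (j : Fin k) =>
      coinPoly (ZMod p) d (extend r) (i * k + j)) = 0 ↔ (coinBlocks (n * k) d t r).1 ∈ bad := by
    intro r
    simp only [bad, Finset.mem_filter, Finset.mem_univ, true_and, G, eval_genericSum]
    have : ∀ (i : Fin n) (j : Fin k), coinPoly (ZMod p) d (extend r) (i * k + j) =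
        bitPoly (ZMod p) d ((coinBlocks (n * k) d t r).1 (finProdFinEquiv (i, j))) := by
      intro i j
      rw [coinPoly]
      congr 1
      funext l
      rw [coinBlocks_apply, finProdFinEquiv_apply_val]
      congr 2
      ring
    simp only [this]
  have hbad : ((Finset.univ.filter fun r : Fin (n * k * d + t) → Bool =>
      (coinBlocks (n * k) d t r).1 ∈ bad).card : ℝ) = bad.card * 2 ^ t := by
    have : (Finset.univ.filter fun r : Fin (n * k * d + t) → Bool =>
      (coinBlocks (n * k) d t r).1 ∈ bad).card = (bad ×ˢ (Finset.univ : Finset (Fin t → Bool))).card :=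
      Finset.card_equiv (coinBlocks (n * k) d t) (by simp)
    rw [this]
    simp
  have hsum := Finset.card_filter_add_card_filter_not (s := Finset.univ)
    (fun r : Fin (n * k * d + t) → Bool => (coinBlocks (n * k) d t r).1 ∈ bad)
  simp only [Finset.card_univ, Fintype.card_fun, Fintype.card_fin, Fintype.card_bool] at hsum
  have hsum' : ((Finset.univ.filter fun r : Fin (n * k * d + t) → Bool =>
      (coinBlocks (n * k) d t r).1 ∈ bad).card : ℝ) + ((Finset.univ.filter fun r : Fin (n * k * d + t) → Bool =>
      ¬ (coinBlocks (n * k) d t r).1 ∈ bad).card : ℝ) = 2 ^ (n * k * d + t) := by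
    exact_mod_cast hsum
  simp only [coinProb, ne_eq, hiff]
  rw [hbad] at hsum'
  have hd : (0 : ℝ) < 2 ^ d := by positivity
  rw [le_div_iff₀ (by positivity), sub_mul, div_mul_eq_mul_div, sub_le_iff_le_add, one_mul]
  have h3 : (bad.card : ℝ) * 2 ^ t ≤ k * 2 ^ (n * k * d + t) / 2 ^ d := by
    rw [le_div_iff₀ hd, pow_add]
    have := mul_le_mul_of_nonneg_right hbound (by positivity : (0 : ℝ) ≤ 2 ^ t)
    linarith
  have h4 : ∀ inst1 : DecidablePred fun r : Fin (n * k * d + t) → Bool => ¬ (coinBlocks (n * k) d t r).1 ∈ bad,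
     (@Finset.filter _ (fun r : Fin (n * k * d + t) → Bool => ¬ (coinBlocks (n * k) d t r).1 ∈ bad) inst1
      Finset.univ).card = (Finset.univ.filter fun r : Fin (n * k * d + t) → Bool =>
      ¬ (coinBlocks (n * k) d t r).1 ∈ bad).card := fun inst1 => by congr!
  rw [h4]
  linarith

/-- This makes `k * d + 1` coefficients enough to decide whether the sum is zero. -/
theorem natDegree_alternatingSum_lt {p : ℕ} {n k : ℕ}
    (F : MvPolynomial (Fin n) (ZMod p)) (hF : F.totalDegree ≤ k) (d : ℕ) (coins : ℕ → Bool) :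
    (alternatingSum F (fun (i : Fin n) (j : Fin k) =>
      coinPoly (ZMod p) d coins (i * k + j))).natDegree < k * d + 1 := by
  rw [Nat.lt_succ_iff]
  refine Polynomial.natDegree_sum_le_of_forall_le _ _ fun b _ => ?_
  have h1 : (∏ j, (1 - 2 * ((b j : ℕ) : Polynomial (ZMod p)))) =
      Polynomial.C (∏ j, (1 - 2 * ((b j : ℕ) : ZMod p))) := by
    simp only [map_prod, map_sub, map_one, map_mul, map_ofNat, map_natCast]
  rw [h1]
  refine (Polynomial.natDegree_C_mul_le _ _).trans ((natDegree_aeval_le F _ d fun i => ?_).trans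
    (Nat.mul_le_mul_right _ hF))
  refine Polynomial.natDegree_sum_le_of_forall_le _ _ fun j _ => ?_
  rw [← map_natCast Polynomial.C]
  refine (Polynomial.natDegree_C_mul_le _ _).trans ?_
  refine Polynomial.natDegree_le_iff_coeff_eq_zero.2 fun l hl => ?_
  simp only [coinPoly, coeff_bitPoly]
  exact dif_neg hl.not_gt

/-- The alternating sum, with the subsets of the columns numbered by their binary expansions. -/
theorem alternatingSum_eq_sum_range {K R : Type*} [CommRing K] [CommRing R] [Algebra K R] {n k : ℕ}
    (F : MvPolynomial (Fin n) K) (a : Fin n → ℕ → R) :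
    alternatingSum F (fun i (j : Fin k) => a i j) =
      ∑ b ∈ Finset.range (2 ^ k), (∏ j ∈ Finset.range k, (1 - 2 * ((b / 2 ^ j % 2 : ℕ) : R))) *
        MvPolynomial.aeval (fun i => ∑ j ∈ Finset.range k, ((b / 2 ^ j % 2 : ℕ) : R) * a i j) F := by
  rw [Finset.sum_range, alternatingSum, ← finFunctionFinEquiv.symm.sum_comp]
  refine Finset.sum_congr rfl fun b _ => ?_
  simp only [Finset.prod_range, Finset.sum_range, finFunctionFinEquiv, Equiv.ofRightInverseOfCardLE,
    Equiv.coe_fn_symm_mk]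

/-! ### Reasoning about programs -/

/-- The values of `e` have at most `e.valueWeight` times as many bits as the memory cells. -/
def Expr.valueWeight : Expr → ℕ
  | .lit c => c.size
  | .get _ _ => 1
  | .op _ e₁ e₂ => e₁.valueWeight + e₂.valueWeight + 1

/-- The cost of `e` is at most `e.weight` times the square of the bit length of the cells. -/
def Expr.weight : Expr → ℕ
  | .lit c => 1 + c.size
  | .get _ e => e.weight + (1 + e.valueWeight)
  | .op _ e₁ e₂ => e₁.weight + e₂.weight + (1 + e₁.valueWeight) * (1 + e₂.valueWeight)

/-- All memory cells hold numbers at most `M`. -/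
def Memory.Bounded (M : ℕ) (μ : Memory) : Prop := ∀ a i, μ a i ≤ M

/-- The bit length of a number at most `M`, plus one. -/
def wordLength (M : ℕ) : ℕ := M.size + 1

theorem wordLength_pos (M : ℕ) : 0 < wordLength M := Nat.succ_pos _

theorem size_mul_le (x y : ℕ) : (x * y).size ≤ x.size + y.size := by
  rw [Nat.size_le, pow_add]
  exact Nat.mul_lt_mul'' (Nat.lt_size_self x) (Nat.lt_size_self y)

theorem size_add_le (x y : ℕ) : (x + y).size ≤ x.size + y.size + 1 := by
  rw [Nat.size_le, pow_succ, pow_add]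
  have hx := Nat.lt_size_self x
  have hy := Nat.lt_size_self y
  have h1 := Nat.one_le_two_pow (n := x.size)
  have h2 := Nat.one_le_two_pow (n := y.size)
  nlinarith

theorem Op.size_eval_le (o : Op) (x y : ℕ) : (o.eval x y).size ≤ x.size + y.size + 1 := by
  cases o with
  | add => exact size_add_le x y
  | sub => exact (Nat.size_le_size (Nat.sub_le x y)).trans (by omega)
  | mul => exact (size_mul_le x y).trans (by omega)
  | div => exact (Nat.size_le_size (Nat.div_le_self x y)).trans (by omega)
  | mod => exact (Nat.size_le_size (Nat.mod_le x y)).trans (by omega)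

theorem Op.cost_le (o : Op) (x y : ℕ) : o.cost x y ≤ (1 + x.size) * (1 + y.size) := by
  cases o <;> simp only [Op.cost] <;> nlinarith [Nat.zero_le (x.size * y.size)]

theorem Expr.size_eval_le {M : ℕ} {μ : Memory} (hμ : μ.Bounded M) (e : Expr) :
    (e.eval μ).size ≤ e.valueWeight * wordLength M := by
  have hL : 1 ≤ wordLength M := wordLength_pos M
  induction e with
  | lit c => simpa [Expr.eval, valueWeight] using Nat.le_mul_of_pos_right c.size hL
  | get a e _ =>
    rw [Expr.eval, valueWeight, one_mul]
    exact (Nat.size_le_size (hμ _ _)).trans (Nat.le_succ _)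
  | op o e₁ e₂ h₁ h₂ =>
    rw [Expr.eval, valueWeight]
    refine (o.size_eval_le _ _).trans ?_
    nlinarith

theorem Expr.cost_le {M : ℕ} {μ : Memory} (hμ : μ.Bounded M) (e : Expr) :
    e.cost μ ≤ e.weight * wordLength M ^ 2 := by
  have hL : 1 ≤ wordLength M := wordLength_pos M
  have hL2 : wordLength M ≤ wordLength M ^ 2 := Nat.le_self_pow two_ne_zero _
  induction e with
  | lit c => exact Nat.le_mul_of_pos_right _ (by positivity)
  | get a e ih =>
    have h1 := e.size_eval_le hμ
    have h2 : (μ a (e.eval μ)).size + 1 ≤ wordLength M :=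
      Nat.succ_le_succ (Nat.size_le_size (hμ _ _))
    have h3 := Nat.mul_le_mul_left e.valueWeight hL2
    rw [Expr.cost, weight]
    linarith
  | op o e₁ e₂ h₁ h₂ =>
    have h3 := e₁.size_eval_le hμ
    have h4 := e₂.size_eval_le hμ
    have h5 : (1 + (e₁.eval μ).size) * (1 + (e₂.eval μ).size) ≤
        ((1 + e₁.valueWeight) * wordLength M) * ((1 + e₂.valueWeight) * wordLength M) :=
      Nat.mul_le_mul (by linarith) (by linarith)
    have h6 := o.cost_le (e₁.eval μ) (e₂.eval μ)
    rw [Expr.cost, weight]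
    nlinarith

/-- The arrays a program may write to. -/
def Program.writes : Program → List ℕ
  | .skip => []
  | .set a _ _ => [a]
  | .flip a _ => [a]
  | .seq P Q => P.writes ++ Q.writes
  | .ite _ P Q => P.writes ++ Q.writes
  | .while _ P => P.writes

/-- The two memories differ at most in the arrays from `l`. -/
def Memory.AgreeOff (l : List ℕ) (μ ν : Memory) : Prop := ∀ a, a ∉ l → ν a = μ a

theorem Memory.write_apply (μ : Memory) (a i v b j : ℕ) :
    μ.write a i v b j = if b = a ∧ j = i then v else μ b j := by
  by_cases hb : b = a
  · subst hb
    by_cases hj : j = i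
    · subst hj; simp [Memory.write]
    · simp [Memory.write, hj]
  · simp [Memory.write, hb]

theorem Memory.write_of_ne {μ : Memory} {a i v b : ℕ} (h : b ≠ a) : μ.write a i v b = μ b :=
  Function.update_of_ne h _ _

theorem Memory.Bounded.write {M : ℕ} {μ : Memory} (hμ : μ.Bounded M) {a i v : ℕ} (hv : v ≤ M) :
    (μ.write a i v).Bounded M := by
  intro b j
  rw [Memory.write_apply]
  split_ifs
  · exact hv
  · exact hμ b j

/-- A syntactic frame rule. For a concrete program, membership in `writes` can be decided, which is
how unchanged arrays are tracked below. -/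
theorem Exec.agreeOff {P : Program} {σ τ : State} {t : ℕ} (h : Exec P σ t τ) :
    σ.mem.AgreeOff P.writes τ.mem := by
  induction h with
  | skip σ => exact fun _ _ => rfl
  | set σ a i e => exact fun b hb => Memory.write_of_ne (by simpa [Program.writes] using hb)
  | flip σ a i => exact fun b hb => Memory.write_of_ne (by simpa [Program.writes] using hb)
  | seq _ _ h₁ h₂ =>
    intro b hb
    simp only [Program.writes, List.mem_append, not_or] at hb
    rw [h₂ b hb.2, h₁ b hb.1]
  | ite_true _ _ h =>
    intro b hb
    simp only [Program.writes, List.mem_append, not_or] at hb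
    exact h b hb.1
  | ite_false _ _ h =>
    intro b hb
    simp only [Program.writes, List.mem_append, not_or] at hb
    exact h b hb.2
  | while_true _ _ _ h₁ h₂ => exact fun b hb => (h₂ b hb).trans (h₁ b hb)
  | while_false => exact fun _ _ => rfl

/-- From the state `σ`, if its cells are at most `M`, the program halts in a state that satisfies
`Q` and has all cells at most `M`, at cost at most `n` times the square of the word length. -/
def Wp (M n : ℕ) (P : Program) (σ : State) (Q : State → Prop) : Prop :=
  σ.mem.Bounded M → ∃ t τ, Exec P σ t τ ∧ t ≤ n * wordLength M ^ 2 ∧ τ.mem.Bounded M ∧ Q τ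

theorem Wp.mono {M n n' : ℕ} {P : Program} {σ : State} {Q Q' : State → Prop} (h : Wp M n P σ Q)
    (hn : n ≤ n') (hQ : ∀ τ, σ.mem.AgreeOff P.writes τ.mem → Q τ → Q' τ) : Wp M n' P σ Q' := by
  intro hσ
  obtain ⟨t, τ, he, ht, hb, hq⟩ := h hσ
  exact ⟨t, τ, he, ht.trans (Nat.mul_le_mul_right _ hn), hb, hQ τ he.agreeOff hq⟩

theorem wp_skip {M n : ℕ} {σ : State} {Q : State → Prop} (hn : 1 ≤ n) (h : Q σ) :
    Wp M n .skip σ Q := fun hσ =>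
  ⟨1, σ, .skip σ, Nat.mul_pos hn (pow_pos (wordLength_pos M) 2), hσ, h⟩

/-- The cost of an assignment. -/
def setWeight (i e : Expr) : ℕ := i.weight + e.weight + (1 + i.valueWeight + e.valueWeight)

theorem wp_set {M n a : ℕ} {i e : Expr} {σ : State} {Q : State → Prop}
    (hn : setWeight i e ≤ n) (hv : e.eval σ.mem ≤ M)
    (h : Q ⟨σ.mem.write a (i.eval σ.mem) (e.eval σ.mem), σ.coins⟩) :
    Wp M n (.set a i e) σ Q := fun hσ => by
  refine ⟨_, _, .set σ a i e, ?_, hσ.write hv, h⟩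
  refine le_trans ?_ (Nat.mul_le_mul_right _ hn)
  have hL : 1 ≤ wordLength M := wordLength_pos M
  have hL2 : wordLength M ≤ wordLength M ^ 2 := Nat.le_self_pow two_ne_zero _
  have h1 := i.cost_le hσ
  have h2 := e.cost_le hσ
  have h3 := i.size_eval_le hσ
  have h4 := e.size_eval_le hσ
  have h5 := Nat.mul_le_mul_left (i.valueWeight + e.valueWeight) hL2
  rw [setWeight]
  nlinarith

theorem wp_flip {M n a : ℕ} {i : Expr} {σ : State} {Q : State → Prop}
    (hn : i.weight + (1 + i.valueWeight) ≤ n) (hM : 1 ≤ M)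
    (h : Q ⟨σ.mem.write a (i.eval σ.mem) (σ.coins 0).toNat, fun j => σ.coins (j + 1)⟩) :
    Wp M n (.flip a i) σ Q := fun hσ => by
  refine ⟨_, _, .flip σ a i, ?_, hσ.write ((Bool.toNat_le _).trans hM), h⟩
  refine le_trans ?_ (Nat.mul_le_mul_right _ hn)
  have hL : 1 ≤ wordLength M := wordLength_pos M
  have hL2 : wordLength M ≤ wordLength M ^ 2 := Nat.le_self_pow two_ne_zero _
  have h1 := i.cost_le hσ
  have h3 := i.size_eval_le hσ
  have h5 := Nat.mul_le_mul_left i.valueWeight hL2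
  nlinarith

theorem wp_seq {M n₁ n₂ n : ℕ} {P Q : Program} {σ : State} {R S : State → Prop}
    (h₁ : Wp M n₁ P σ R) (h₂ : ∀ τ, σ.mem.AgreeOff P.writes τ.mem → R τ → Wp M n₂ Q τ S)
    (hn : n₁ + n₂ ≤ n) : Wp M n (.seq P Q) σ S := fun hσ => by
  obtain ⟨t, τ, he, ht, hb, hq⟩ := h₁ hσ
  obtain ⟨t', τ', he', ht', hb', hq'⟩ := h₂ τ he.agreeOff hq hb
  refine ⟨_, _, .seq he he', ?_, hb', hq'⟩
  calc t + t' ≤ (n₁ + n₂) * wordLength M ^ 2 := by rw [add_mul]; exact add_le_add ht ht'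
    _ ≤ _ := Nat.mul_le_mul_right _ hn

theorem wp_ite {M m n : ℕ} {b : Expr} {P Q : Program} {σ : State} {R : State → Prop}
    (h₁ : b.eval σ.mem ≠ 0 → Wp M m P σ R) (h₂ : b.eval σ.mem = 0 → Wp M m Q σ R)
    (hn : b.weight + 1 + m ≤ n) : Wp M n (.ite b P Q) σ R := fun hσ => by
  have hL := pow_pos (wordLength_pos M) 2
  have hc := b.cost_le hσ
  have hn' := Nat.mul_le_mul_right (wordLength M ^ 2) hn
  by_cases hb : b.eval σ.mem = 0
  · obtain ⟨t, τ, he, ht, hb', hq⟩ := h₂ hb hσ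
    exact ⟨_, τ, .ite_false hb he, by nlinarith, hb', hq⟩
  · obtain ⟨t, τ, he, ht, hb', hq⟩ := h₁ hb hσ
    exact ⟨_, τ, .ite_true hb he, by nlinarith, hb', hq⟩

/-- The content of the cell `0` of the array `a`. -/
abbrev Expr.var (a : ℕ) : Expr := .get a (.lit 0)

/-- Run `P` for `v = 0, …, b - 1`, where `v` is the cell `0` of an array. -/
def forLoop (v : ℕ) (b : Expr) (P : Program) : Program :=
  .seq (.set v (.lit 0) (.lit 0))
    (.while (.op .sub b (.var v)) (.seq P (.set v (.lit 0) (.op .add (.var v) (.lit 1)))))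

/-- Up to the factor for the word length, the cost of a loop with `n` rounds of cost `c`. -/
def forCost (b : Expr) (n c : ℕ) : ℕ := (n + 1) * (c + (b.weight + 2 * b.valueWeight + 30))

/-- The loop invariant may not depend on the counter cell (`hI`), and the bound is re-evaluated in
every round, so it must be stable under whatever the loop writes (`hb`). -/
theorem wp_forLoop {M N v n c : ℕ} {b : Expr} {P : Program} {σ : State} (I : ℕ → State → Prop)
    (hv : v ∉ P.writes) (hnM : n ≤ M)
    (hI : ∀ j τ x, I j τ → I j ⟨τ.mem.write v 0 x, τ.coins⟩)
    (h0 : I 0 σ)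
    (hb : ∀ τ : State, σ.mem.AgreeOff (v :: P.writes) τ.mem → b.eval τ.mem = n)
    (hP : ∀ j < n, ∀ τ : State, I j τ → τ.mem v 0 = j → σ.mem.AgreeOff (v :: P.writes) τ.mem →
      Wp M c P τ (I (j + 1)))
    (hN : forCost b n c ≤ N) :
    Wp M N (forLoop v b P) σ (I n) := by
  set w := b.weight + 2 * b.valueWeight + 30 with hw
  -- Induction on the number `m` of remaining rounds. A round pays `w - 14` for the test, `c` for
  -- the body and `13` for the increment; the extra `w - 14` pays for the final failing test.
  have hloop : ∀ m j, j + m = n → ∀ τ : State, τ.mem.Bounded M → I j τ → τ.mem v 0 = j →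
      σ.mem.AgreeOff (v :: P.writes) τ.mem → ∃ t τ',
      Exec (.while (.op .sub b (.var v)) (.seq P (.set v (.lit 0) (.op .add (.var v) (.lit 1))))) τ
        t τ' ∧ t ≤ (m * (c + w) + (w - 14)) * wordLength M ^ 2 ∧ τ'.mem.Bounded M ∧ I n τ' := by
    have hL : 1 ≤ wordLength M := wordLength_pos M
    have hL2 := pow_pos (wordLength_pos M) 2
    have hcond : ∀ τ : State, τ.mem.Bounded M →
        (Expr.op .sub b (.var v)).cost τ.mem + 1 ≤ (w - 14) * wordLength M ^ 2 := by
      intro τ hτ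
      have h1 := (Expr.op .sub b (.var v)).cost_le hτ
      have h2 : (Expr.op .sub b (.var v)).weight + 1 ≤ w - 14 := by
        simp only [Expr.weight, Expr.valueWeight, Nat.size_zero, hw]
        omega
      nlinarith [Nat.mul_le_mul_right (wordLength M ^ 2) h2]
    intro m
    induction m with
    | zero =>
      intro j hj τ hτ hIj hvj hag
      have hjn : j = n := by omega
      subst hjn
      refine ⟨_, τ, .while_false ?_, ?_, hτ, hIj⟩
      · simp [Expr.eval, Op.eval, hb τ hag, hvj]
      · rw [zero_mul, zero_add]
        exact hcond τ hτ
    | succ m ih =>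
      intro j hj τ hτ hIj hvj hag
      obtain ⟨t₁, τ₁, he₁, ht₁, hb₁, hI₁⟩ := hP j (by omega) τ hIj hvj hag hτ
      have hag₁ := he₁.agreeOff
      have hv₁ : τ₁.mem v 0 = j := by rw [hag₁ v hv, hvj]
      obtain ⟨t₂, τ₂, he₂, ht₂, hb₂, hτ₂⟩ :=
        wp_set (M := M) (a := v) (i := .lit 0) (e := .op .add (.var v) (.lit 1)) (n := 13) (σ := τ₁)
          (Q := fun τ₂ => τ₂ = ⟨τ₁.mem.write v 0 (j + 1), τ₁.coins⟩)
          (by simp [setWeight, Expr.weight, Expr.valueWeight]) (by simp only [Expr.eval, Op.eval, hv₁]; omega)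
          (by simp only [Expr.eval, Op.eval, hv₁]) hb₁
      subst hτ₂
      obtain ⟨t₃, τ₃, he₃, ht₃, hb₃, hI₃⟩ := ih (j + 1) (by omega) _ hb₂ (hI _ _ _ hI₁)
        (by simp [Memory.write_apply]) (by
          intro a ha
          simp only [List.mem_cons, not_or] at ha
          dsimp only
          rw [Memory.write_of_ne ha.1, hag₁ a ha.2, hag a (by simp [ha])])
      refine ⟨_, τ₃, .while_true ?_ (.seq he₁ he₂) he₃, ?_, hb₃, hI₃⟩
      · simp only [Expr.eval, Op.eval, hb τ hag, hvj]
        omega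
      · have := hcond τ hτ
        have h10 : w = (w - 14) + 14 := by omega
        rw [h10] at ht₃ ⊢
        generalize w - 14 = w' at *
        simp only [Nat.add_sub_cancel] at ht₃ ⊢
        nlinarith
  intro hσ
  obtain ⟨t₁, τ₁, he₁, ht₁, hb₁, hτ₁⟩ :=
    wp_set (M := M) (a := v) (i := .lit 0) (e := .lit 0) (n := 3) (σ := σ)
      (Q := fun τ₂ => τ₂ = ⟨σ.mem.write v 0 0, σ.coins⟩)
      (by decide) (by simp [Expr.eval]) (by simp [Expr.eval]) hσ
  subst hτ₁
  obtain ⟨t₃, τ₃, he₃, ht₃, hb₃, hI₃⟩ := hloop n 0 (by omega) _ hb₁ (hI _ _ _ h0)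
    (by simp [Memory.write_apply]) (by
      intro a ha
      simp only [List.mem_cons, not_or] at ha
      exact Memory.write_of_ne ha.1)
  refine ⟨_, τ₃, .seq he₁ he₃, ?_, hb₃, hI₃⟩
  refine le_trans ?_ (Nat.mul_le_mul_right _ hN)
  rw [forCost, ← hw]
  have h10 : w = (w - 14) + 14 := by omega
  rw [h10] at ht₃ ⊢
  generalize w - 14 = w' at *
  simp only [Nat.add_sub_cancel] at ht₃ ⊢
  nlinarith [pow_pos (wordLength_pos M) 2]

/-! ### Circuits -/

theorem foldl_gates_length {R : Type*} [CommSemiring R] (gs : List Gate) (v : List R) :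
    (gs.foldl (fun vals g => vals ++ [g.value vals]) v).length = v.length + gs.length := by
  induction gs generalizing v with
  | nil => rfl
  | cons g gs ih => rw [List.foldl_cons, ih, List.length_append, List.length_cons]; simp; omega

theorem foldl_gates_getD {R : Type*} [CommSemiring R] (gs : List Gate) (v : List R) (i : ℕ)
    (hi : i < v.length) :
    (gs.foldl (fun vals g => vals ++ [g.value vals]) v).getD i 0 = v.getD i 0 := by
  induction gs generalizing v with
  | nil => rfl
  | cons g gs ih =>
    rw [List.foldl_cons, ih _ (by rw [List.length_append]; omega), List.getD_append _ _ _ _ hi]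

theorem Gate.value_congr {R : Type*} [CommSemiring R] (g : Gate) (v w : List R)
    (h : ∀ i ∈ g.inputs, v.getD i 0 = w.getD i 0) : g.value v = g.value w := by
  cases g with
  | add l hl =>
    simp only [Gate.value]
    exact congrArg List.sum (List.map_congr_left h)
  | mul a b =>
    simp only [Gate.value]
    rw [h a (by simp [Gate.inputs]), h b (by simp [Gate.inputs])]

theorem Circuit.nodePolys_getD_var {n : ℕ} (C : Circuit n) (R : Type*) [CommSemiring R] (i : ℕ)
    (hi : i < n) : (C.nodePolys R).getD i 0 = MvPolynomial.X ⟨i, hi⟩ := by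
  rw [Circuit.nodePolys, foldl_gates_getD _ _ _ (by simpa using hi)]
  simp [hi]

/-- A gate is evaluated on the prefix of earlier nodes. Later nodes are only appended and its inputs
lie in that prefix, so its equation also holds in the complete list. -/
theorem Circuit.nodePolys_getD_gate {n : ℕ} (C : Circuit n) (R : Type*) [CommSemiring R] (j : ℕ)
    (hj : j < C.gates.length) :
    (C.nodePolys R).getD (n + j) 0 = C.gates[j].value (C.nodePolys R) := by
  have hsplit : C.gates = C.gates.take j ++ C.gates[j] :: C.gates.drop (j + 1) := by simp
  set v : List (MvPolynomial (Fin n) R) := (C.gates.take j).foldl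
    (fun vals g => vals ++ [g.value vals]) (List.ofFn fun i => MvPolynomial.X i) with hv
  have hlen : v.length = n + j := by
    rw [hv, foldl_gates_length]; simp; omega
  have hall : C.nodePolys R = (C.gates.drop (j + 1)).foldl
      (fun vals g => vals ++ [g.value vals]) (v ++ [C.gates[j].value v]) := by
    rw [Circuit.nodePolys]
    conv_lhs => rw [hsplit]
    rw [List.foldl_append, List.foldl_cons, ← hv]
  clear_value v
  have hval : C.gates[j].value v = C.gates[j].value (C.nodePolys R) := by
    refine Gate.value_congr _ _ _ fun i hi => ?_
    have hin := C.acyclic j hj i hi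
    rw [hall, foldl_gates_getD _ _ _ (by rw [List.length_append]; omega),
      List.getD_append _ _ _ _ (by omega)]
  rw [← hval, hall, foldl_gates_getD _ _ _ (by rw [List.length_append, hlen]; simp),
    List.getD_append_right _ _ _ _ (by omega), hlen]
  simp

/-- The position in the input at which the description of the `j`-th gate starts. -/
def Circuit.gatePos {n : ℕ} (C : Circuit n) (j : ℕ) : ℕ := 5 + ((C.gates.take j).flatMap Gate.encode).length

theorem Circuit.gatePos_succ {n : ℕ} (C : Circuit n) (j : ℕ) (hj : j < C.gates.length) :
    C.gatePos (j + 1) = C.gatePos j + C.gates[j].encode.length := by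
  simp only [gatePos, ← List.take_concat_get' _ _ hj, List.flatMap_append, List.length_append,
    List.flatMap_cons, List.flatMap_nil, List.append_nil, add_assoc]

theorem Circuit.gatePos_le {n : ℕ} (C : Circuit n) (p k j : ℕ) :
    C.gatePos j ≤ (encodeInput p k C).length := by
  have : C.gates.flatMap Gate.encode =
      (C.gates.take j).flatMap Gate.encode ++ (C.gates.drop j).flatMap Gate.encode := by
    rw [← List.flatMap_append, List.take_append_drop]
  simp only [gatePos, encodeInput, List.length_cons, this, List.length_append]
  omega

theorem Circuit.encodeInput_getD {n : ℕ} (C : Circuit n) (p k j q : ℕ) (hj : j < C.gates.length)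
    (hq : q < C.gates[j].encode.length) :
    (encodeInput p k C).getD (C.gatePos j + q) 0 = C.gates[j].encode.getD q 0 := by
  have hsplit : C.gates = C.gates.take j ++ C.gates[j] :: C.gates.drop (j + 1) := by simp
  have : C.gates.flatMap Gate.encode = (C.gates.take j).flatMap Gate.encode ++
      (C.gates[j].encode ++ (C.gates.drop (j + 1)).flatMap Gate.encode) := by
    conv_lhs => rw [hsplit]
    rw [List.flatMap_append, List.flatMap_cons]
  simp only [gatePos, encodeInput, this]
  rw [show 5 + ((C.gates.take j).flatMap Gate.encode).length + q =
    ((C.gates.take j).flatMap Gate.encode).length + q + 1 + 1 + 1 + 1 + 1 by omega]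
  simp only [List.getD_cons_succ]
  rw [List.getD_append_right _ _ _ _ (by omega), Nat.add_sub_cancel_left, List.getD_append _ _ _ _ hq]

/-- Distinctness of the inputs is what bounds the fan-in, hence the input length and the cost of a
`+` gate. -/
theorem Gate.length_inputs_le {n : ℕ} (C : Circuit n) (j : ℕ) (hj : j < C.gates.length)
    (l : List ℕ) (hl : l.Nodup) (h : C.gates[j] = .add l hl) : l.length ≤ n + j := by
  have hsub : l ⊆ List.range (n + j) := by
    intro i hi
    exact List.mem_range.2 (C.acyclic j hj i (by rw [h]; exact hi))
  simpa using (hl.subperm hsub).length_le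

theorem length_encodeInput_le {n : ℕ} (C : Circuit n) (p k : ℕ) :
    (encodeInput p k C).length ≤ 5 + C.size * (n + C.size + 3) := by
  simp only [encodeInput, List.length_cons, List.length_flatMap]
  have : (C.gates.map fun g => g.encode.length).sum ≤ C.gates.length * (n + C.size + 3) := by
    have h := List.sum_le_card_nsmul (C.gates.map fun g => g.encode.length) (n + C.size + 3) (by
      intro x hx
      obtain ⟨g, hg, rfl⟩ := List.mem_map.1 hx
      obtain ⟨j, hj, rfl⟩ := List.getElem_of_mem hg
      match hgate : C.gates[j] with
      | .add l hl =>
        have := Gate.length_inputs_le C j hj l hl hgate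
        simp only [Gate.encode, List.length_cons, Circuit.size]
        omega
      | .mul a b =>
        simp only [Gate.encode, List.length_cons, List.length_nil]
        omega)
    simpa using h
  rw [Circuit.size] at *
  omega

theorem encodeInput_le {n : ℕ} (C : Circuit n) (p k i : ℕ) :
    (encodeInput p k C).getD i 0 ≤ p + k + n + C.size + 1 := by
  have hmem : ∀ x ∈ encodeInput p k C, x ≤ p + k + n + C.size + 1 := by
    intro x hx
    have hout := C.out_lt
    simp only [encodeInput, List.mem_cons, List.mem_flatMap, Circuit.size] at hx ⊢
    rcases hx with rfl | rfl | rfl | rfl | rfl | ⟨g, hg, hx⟩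
    · omega
    · omega
    · omega
    · omega
    · omega
    · obtain ⟨j, hj, rfl⟩ := List.getElem_of_mem hg
      have hac := C.acyclic j hj
      match hgate : C.gates[j] with
      | .add l hl =>
        have := Gate.length_inputs_le C j hj l hl hgate
        rw [hgate] at hx hac
        simp only [Gate.encode, List.mem_cons] at hx
        rcases hx with rfl | rfl | hx
        · omega
        · omega
        · have := hac x hx; omega
      | .mul a b =>
        rw [hgate] at hx hac
        simp only [Gate.encode, Gate.inputs, List.mem_cons, List.not_mem_nil, or_false] at hx hac
        have h1 := hac a (by simp)
        have h2 := hac b (by simp)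
        rcases hx with rfl | rfl | rfl <;> omega
  rcases lt_or_ge i (encodeInput p k C).length with h | h
  · rw [List.getD_eq_getElem _ _ h]
    exact hmem _ (List.getElem_mem h)
  · rw [List.getD_eq_default _ _ h]
    omega

/-! ### The program -/

local infixl:65 " +ₑ " => Expr.op Op.add
local infixl:65 " -ₑ " => Expr.op Op.sub
local infixl:70 " *ₑ " => Expr.op Op.mul
local infixl:70 " /ₑ " => Expr.op Op.div
local infixl:70 " %ₑ " => Expr.op Op.mod

/-- The accumulator (array `8`) becomes the sum of `term` for `t < b`, modulo `p`, where `t` is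
array `9` and `p` is the first number of the input. -/
def sumLoop (b term : Expr) : Program :=
  .seq (.set 8 (.lit 0) (.lit 0)) (forLoop 9 b (.set 8 (.lit 0) ((.var 8 +ₑ term) %ₑ .var 0)))

/-- For all `l < N`, the `l`-th coefficient of the given row of array `3` becomes the sum of
`term` for `t < b`, modulo `p`; here `N` is array `7`, `l` is array `10`, `t` is array `9`. -/
def fillRow (row b term : Expr) : Program :=
  forLoop 10 (.var 7) (.seq (sumLoop b term) (.set 3 (row *ₑ .var 7 +ₑ .var 10) (.var 8)))

/-! ### Sums modulo `p` and rows of coefficients -/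

theorem Memory.AgreeOff.mono {l l' : List ℕ} {μ ν : Memory} (h : μ.AgreeOff l ν) (hl : l ⊆ l') :
    μ.AgreeOff l' ν := fun a ha => h a fun ha' => ha (hl ha')

theorem Memory.AgreeOff.trans {l : List ℕ} {μ ν ρ : Memory} (h : μ.AgreeOff l ν)
    (h' : ν.AgreeOff l ρ) : μ.AgreeOff l ρ := fun a ha => (h' a ha).trans (h a ha)

/-- Reducing after every addition keeps the accumulator below `p`, hence within the cell bound `M`.
-/
theorem wp_sumLoop {M m p n W : ℕ} {b term : Expr} {σ : State} (f : ℕ → ℕ) (hn : n ≤ M)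
    (hp : 0 < p) (hpM : p ≤ M) (h0 : σ.mem 0 0 = p)
    (hb : ∀ μ : Memory, σ.mem.AgreeOff [8, 9] μ → b.eval μ = n)
    (hterm : ∀ t < n, ∀ μ : Memory, σ.mem.AgreeOff [8, 9] μ → μ 9 0 = t → term.eval μ = f t)
    (hWb : b.weight + 2 * b.valueWeight ≤ W) (hWt : term.weight + 5 * term.valueWeight ≤ W)
    (hm : (n + 1) * (2 * W + 60) + 5 ≤ m) :
    Wp M m (sumLoop b term) σ (fun τ => τ.mem 8 0 = (∑ t ∈ Finset.range n, f t) % p) := by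
  refine wp_seq (n₁ := 5) (n₂ := (n + 1) * (2 * W + 60)) (R := fun τ => τ.mem 8 0 = 0)
    (wp_set (by decide) (Nat.zero_le _) (by simp [Expr.eval, Memory.write_apply])) ?_ (by omega)
  intro τ hτ h8
  have hτ' : σ.mem.AgreeOff [8, 9] τ.mem := hτ.mono (by simp [Program.writes])
  refine wp_forLoop (n := n) (c := W + 30)
    (fun j ρ => ρ.mem 8 0 = (∑ t ∈ Finset.range j, f t) % p) (by simp [Program.writes]) hn
    (fun j ρ x h => by simpa [Memory.write_apply] using h) (by simpa using h8)
    (fun ρ hρ => hb _ (hτ'.trans (hρ.mono (by simp [Program.writes])))) ?_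
    (Nat.mul_le_mul_left _ (by omega))
  intro j hj ρ hI hj' hρ
  have hag := hτ'.trans (hρ.mono (l' := [8, 9]) (by simp [Program.writes]))
  have ht := hterm j hj _ hag hj'
  have hp0 : ρ.mem 0 0 = p := by rw [hag 0 (by decide), h0]
  have hval : ((Expr.var 8 +ₑ term) %ₑ .var 0).eval ρ.mem = (∑ t ∈ Finset.range (j + 1), f t) % p := by
    simp only [Expr.eval, Op.eval, ht, hI, hp0, Finset.sum_range_succ, Nat.mod_add_mod]
  refine wp_set ?_ ?_ ?_
  · simp only [setWeight, Expr.weight, Expr.valueWeight, Nat.size_zero]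
    omega
  · rw [hval]
    exact (Nat.mod_lt _ hp).le.trans hpM
  · simp only [hval]
    simp [Expr.eval, Memory.write_apply]

/-- The terms may read the rows before row `r`, which stay intact while row `r` is written. This is
what a gate needs to use earlier nodes. -/
theorem wp_fillRow {M m p N B r W : ℕ} {row b term : Expr} {σ : State} (n : ℕ → ℕ) (f : ℕ → ℕ → ℕ)
    (hN : N ≤ M) (hB : B ≤ M) (hn : ∀ l < N, n l ≤ B) (hp : 0 < p) (hpM : p ≤ M)
    (h0 : σ.mem 0 0 = p) (h7 : σ.mem 7 0 = N)
    (hrow : ∀ μ : Memory, σ.mem.AgreeOff [8, 9, 10, 3] μ → row.eval μ = r)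
    (hb : ∀ l < N, ∀ μ : Memory, σ.mem.AgreeOff [8, 9, 10, 3] μ → μ 10 0 = l → b.eval μ = n l)
    (hterm : ∀ l < N, ∀ t < n l, ∀ μ : Memory, σ.mem.AgreeOff [8, 9, 10, 3] μ →
      (∀ c < r * N, μ 3 c = σ.mem 3 c) → μ 10 0 = l → μ 9 0 = t → term.eval μ = f l t)
    (hWr : row.weight + 5 * row.valueWeight ≤ W)
    (hWb : b.weight + 2 * b.valueWeight ≤ W) (hWt : term.weight + 5 * term.valueWeight ≤ W)
    (hm : (N + 1) * ((B + 1) * (3 * W + 200)) ≤ m) :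
    Wp M m (fillRow row b term) σ (fun τ =>
      (∀ l < N, τ.mem 3 (r * N + l) = (∑ t ∈ Finset.range (n l), f l t) % p) ∧
      ∀ c < r * N, τ.mem 3 c = σ.mem 3 c) := by
  have hwr : ∀ v, v :: (Program.seq (sumLoop b term) (.set 3 (row *ₑ .var 7 +ₑ .var 10) (.var 8))).writes =
      [v, 8, 9, 8, 9, 3] := fun v => rfl
  have hws : (sumLoop b term).writes = [8, 9, 8, 9] := rfl
  -- The subtracted `45` makes room for the overhead of the loop itself.
  refine wp_forLoop (n := N) (c := (B + 1) * (3 * W + 200) - 45)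
    (fun j ρ => (∀ l < j, ρ.mem 3 (r * N + l) = (∑ t ∈ Finset.range (n l), f l t) % p) ∧
      ∀ c < r * N, ρ.mem 3 c = σ.mem 3 c) (by simp [Program.writes, hws]) hN
    (fun j ρ x h => by simpa [Memory.write_apply] using h) ⟨by simp, fun _ _ => rfl⟩
    (fun ρ hρ => ?_) ?_ ?_
  · rw [hwr] at hρ
    simp only [Expr.eval]
    rw [hρ 7 (by decide), h7]
  · intro l hl ρ hI hl' hρ
    rw [hwr] at hρ
    have hρ' : σ.mem.AgreeOff [8, 9, 10, 3] ρ.mem := hρ.mono (by decide)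
    have hc : (n l + 1) * (2 * W + 60) ≤ (B + 1) * (2 * W + 60) :=
      Nat.mul_le_mul_right _ (by have := hn l hl; omega)
    refine wp_seq (n₁ := (B + 1) * (2 * W + 60) + 5) (n₂ := W + 50)
      (wp_sumLoop (f l) ((hn l hl).trans hB) hp hpM (by rw [hρ 0 (by decide), h0])
        (fun μ hμ => hb l hl μ (hρ'.trans (hμ.mono (by decide))) (by rw [hμ 10 (by decide), hl']))
        (fun t ht μ hμ hμt => hterm l hl t ht μ (hρ'.trans (hμ.mono (by decide)))
          (fun c hc => by rw [hμ 3 (by decide), hI.2 c hc]) (by rw [hμ 10 (by decide), hl']) hμt)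
        hWb hWt (by omega)) ?_ ?_
    · intro τ hτ h8
      rw [hws] at hτ
      have hag : σ.mem.AgreeOff [8, 9, 10, 3] τ.mem := hρ'.trans (hτ.mono (by decide))
      have hidx : (row *ₑ .var 7 +ₑ .var 10).eval τ.mem = r * N + l := by
        simp only [Expr.eval, Op.eval, hrow _ hag, hag 7 (by decide), h7, hτ 10 (by decide), hl']
      have hval : (Expr.var 8).eval τ.mem = (∑ t ∈ Finset.range (n l), f l t) % p := h8
      refine wp_set ?_ ?_ ?_
      · simp only [setWeight, Expr.weight, Expr.valueWeight, Nat.size_zero]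
        omega
      · rw [hval]
        exact (Nat.mod_lt _ hp).le.trans hpM
      · simp only [hidx, hval]
        refine ⟨fun l' hl'' => ?_, fun c hc => ?_⟩
        · rw [Memory.write_apply]
          rcases Nat.lt_succ_iff_lt_or_eq.1 hl'' with h | rfl
          · rw [if_neg (by omega), hτ 3 (by decide), hI.1 _ h]
          · rw [if_pos ⟨rfl, rfl⟩]
        · rw [Memory.write_apply, if_neg (by omega), hτ 3 (by decide), hI.2 c hc]
    · have : (B + 1) * (3 * W + 200) = (B + 1) * (2 * W + 60) + (B + 1) * (W + 140) := by ring
      have : W + 140 ≤ (B + 1) * (W + 140) := Nat.le_mul_of_pos_left _ (Nat.succ_pos _)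
      omega
  · refine le_trans (Nat.mul_le_mul_left _ ?_) hm
    have : 200 ≤ (B + 1) * (3 * W + 200) := (by omega : 200 ≤ 3 * W + 200).trans
      (Nat.le_mul_of_pos_left _ (Nat.succ_pos _))
    simp only [Expr.weight, Expr.valueWeight, Nat.size_zero]
    omega

/-- The digit `t` (array `9`) of the number of the current subset (array `13`). -/
def bitExpr : Expr := (.var 13 /ₑ .get 5 (.var 9)) %ₑ .lit 2

/-- The sign of the current subset, modulo `p`, is written to array `14`. -/
def signLoop : Program :=
  .seq (.set 14 (.lit 0) (.lit 1)) (forLoop 9 (.get 0 (.lit 1))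
    (.set 14 (.lit 0) ((.var 14 *ₑ (.lit 1 +ₑ bitExpr *ₑ (.var 0 -ₑ .lit 2))) %ₑ .var 0)))

/-- A summand of the coefficient `l` (array `10`) of the value of the variable `i` (array `11`). -/
def inputTerm : Expr :=
  bitExpr *ₑ .get 2 ((.var 11 *ₑ .get 0 (.lit 1) +ₑ .var 9) *ₑ .var 6 +ₑ .var 10) *ₑ
    (.lit 1 -ₑ .var 10 /ₑ .var 6)

/-- The values of the variables are written to the first rows of array `3`. -/
def inputLoop : Program :=
  forLoop 11 (.get 0 (.lit 2)) (fillRow (.var 11) (.get 0 (.lit 1)) inputTerm)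

/-- The number `i` of the description of the current gate; array `12` points to its start. -/
def gateEntry (i : ℕ) : Expr := .get 0 (.var 12 +ₑ .lit i)

/-- A summand of a coefficient of the product of two rows. -/
def mulTerm : Expr :=
  .get 3 (gateEntry 1 *ₑ .var 7 +ₑ .var 9) *ₑ .get 3 (gateEntry 2 *ₑ .var 7 +ₑ (.var 10 -ₑ .var 9))

/-- A summand of a coefficient of a sum of rows. -/
def addTerm : Expr := .get 3 (.get 0 (.var 12 +ₑ .lit 2 +ₑ .var 9) *ₑ .var 7 +ₑ .var 10)

/-- The node number of the current gate. -/
def gateRow : Expr := .get 0 (.lit 2) +ₑ .var 11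

/-- The value of the current gate is computed. -/
def gateStep : Program :=
  .ite (gateEntry 0)
    (.seq (fillRow gateRow (.var 10 +ₑ .lit 1) mulTerm) (.set 12 (.lit 0) (.var 12 +ₑ .lit 3)))
    (.seq (fillRow gateRow (gateEntry 1) addTerm)
      (.set 12 (.lit 0) (.var 12 +ₑ .lit 2 +ₑ gateEntry 1)))

/-- The values of all gates are computed. -/
def gateLoop : Program :=
  .seq (.set 12 (.lit 0) (.lit 5)) (forLoop 11 (.get 0 (.lit 3)) gateStep)

/-- The signed value of the output is added to array `4`. -/
def accumulateLoop : Program :=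
  forLoop 10 (.var 7) (.set 4 (.var 10)
    ((.get 4 (.var 10) +ₑ .var 14 *ₑ .get 3 (.get 0 (.lit 4) *ₑ .var 7 +ₑ .var 10)) %ₑ .var 0))

/-- The alternating sum over all subsets is computed in array `4`. -/
def subsetLoop : Program :=
  forLoop 13 (.get 5 (.get 0 (.lit 1)))
    (.seq signLoop (.seq inputLoop (.seq gateLoop accumulateLoop)))

/-- The number of random bits per matrix entry and the number of coefficients are written to the
arrays `6` and `7`. -/
def parameterStep (e : ℕ) : Program :=
  .seq (.set 6 (.lit 0) (.lit (e + 1) *ₑ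
      (.get 0 (.lit 2) +ₑ .get 0 (.lit 1) +ₑ .get 0 (.lit 3) +ₑ .lit 2)))
    (.set 7 (.lit 0) (.get 0 (.lit 1) *ₑ .var 6 +ₑ .lit 1))

/-- Array `2` is filled with random bits. -/
def flipLoop : Program :=
  forLoop 15 (.get 0 (.lit 2) *ₑ .get 0 (.lit 1) *ₑ .var 6) (.flip 2 (.var 15))

/-- Array `5` is filled with powers of two. -/
def powerLoop : Program :=
  .seq (.set 5 (.lit 0) (.lit 1)) (forLoop 15 (.get 0 (.lit 1))
    (.set 5 (.var 15 +ₑ .lit 1) (.lit 2 *ₑ .get 5 (.var 15))))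

/-- The answer is `1` if array `4` has a nonzero entry. -/
def answerLoop : Program :=
  forLoop 10 (.var 7) (.ite (.get 4 (.var 10)) (.set 1 (.lit 0) (.lit 1)) .skip)

/-- The program that tests for monomials with error exponent `e`. -/
def testProgram (e : ℕ) : Program :=
  .seq (parameterStep e) (.seq flipLoop (.seq powerLoop (.seq subsetLoop answerLoop)))

/-! ### Fixed data, signs and values of the variables -/

/-- The part of the memory that stays fixed during the summation. -/
structure Static (p k d : ℕ) {n : ℕ} (C : Circuit n) (coins : ℕ → Bool) (μ : Memory) : Prop where
  input : ∀ i, μ 0 i = (encodeInput p k C).getD i 0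
  coin : ∀ c < n * k * d, μ 2 c = (coins c).toNat
  pow : ∀ j ≤ k, μ 5 j = 2 ^ j
  deg : μ 6 0 = d
  len : μ 7 0 = k * d + 1

/-- The bound `M` for the memory cells is large enough. -/
structure LargeBound (p k d : ℕ) {n : ℕ} (C : Circuit n) (M : ℕ) : Prop where
  prime : p ≤ M
  pow : 2 ^ k ≤ M
  coin : n * k * d ≤ M
  deg : d ≤ M
  len : k * d + 1 ≤ M
  input : (encodeInput p k C).length ≤ M
  nodes : n + C.size ≤ M
  rounds : k ≤ M

section
variable {p k d n : ℕ} {C : Circuit n} {coins : ℕ → Bool} {M : ℕ}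

theorem Static.of_agreeOff {μ ν : Memory} {l : List ℕ} (h : Static p k d C coins μ)
    (hl : μ.AgreeOff l ν) (hd : ∀ a ∈ l, a ∉ [0, 2, 5, 6, 7]) : Static p k d C coins ν := by
  have key : ∀ a ∈ [0, 2, 5, 6, 7], ν a = μ a := fun a ha => hl a fun h' => hd a h' ha
  have h0 := key 0 (by decide)
  have h2 := key 2 (by decide)
  have h5 := key 5 (by decide)
  have h6 := key 6 (by decide)
  have h7 := key 7 (by decide)
  exact ⟨by simpa only [h0] using h.input, by simpa only [h2] using h.coin,
    by simpa only [h5] using h.pow, by simpa only [h6] using h.deg, by simpa only [h7] using h.len⟩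

theorem Static.prime_eq {μ : Memory} (h : Static p k d C coins μ) : μ 0 0 = p := h.input 0
theorem Static.degree_eq {μ : Memory} (h : Static p k d C coins μ) : μ 0 1 = k := h.input 1
theorem Static.arity_eq {μ : Memory} (h : Static p k d C coins μ) : μ 0 2 = n := h.input 2
theorem Static.size_eq {μ : Memory} (h : Static p k d C coins μ) : μ 0 3 = C.size := h.input 3
theorem Static.out_eq {μ : Memory} (h : Static p k d C coins μ) : μ 0 4 = C.out := h.input 4

variable (p k d C coins)

/-- The sign of the subset with number `b`. -/
noncomputable def subsetSign (b : ℕ) : ZMod p :=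
  ∏ j ∈ Finset.range k, (1 - 2 * ((b / 2 ^ j % 2 : ℕ) : ZMod p))

/-- The value of the variable `i` for the subset with number `b`. -/
noncomputable def subsetPoint (b i : ℕ) : Polynomial (ZMod p) :=
  ∑ j ∈ Finset.range k, ((b / 2 ^ j % 2 : ℕ) : Polynomial (ZMod p)) *
    coinPoly (ZMod p) d coins (i * k + j)

/-- The value of the node `i` for the subset with number `b`. -/
noncomputable def nodeValue (b i : ℕ) : Polynomial (ZMod p) :=
  MvPolynomial.aeval (fun i : Fin n => subsetPoint p k d coins b i) ((C.nodePolys (ZMod p)).getD i 0)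

/-- The first `i` rows of array `3` hold the values of the first `i` nodes. -/
def RowsCorrect (b i : ℕ) (μ : Memory) : Prop :=
  ∀ i' < i, ∀ l < k * d + 1, μ 3 (i' * (k * d + 1) + l) = ((nodeValue p k d C coins b i').coeff l).val

variable {p k d C coins}

/-- In truncated arithmetic `1 - l / d` is the indicator of `l < d`. For larger `l` the coin index
runs outside the block of this matrix entry, so the factor is needed. -/
theorem coeff_subsetPoint (b i l : ℕ) (hd : 0 < d) :
    (subsetPoint p k d coins b i).coeff l =
      ((∑ t ∈ Finset.range k, b / 2 ^ t % 2 * (coins ((i * k + t) * d + l)).toNat * (1 - l / d) : ℕ) :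
        ZMod p) := by
  simp only [subsetPoint, Polynomial.finsetSum_coeff]
  rw [Nat.cast_sum]
  refine Finset.sum_congr rfl fun t _ => ?_
  rw [← map_natCast Polynomial.C, Polynomial.coeff_C_mul, coinPoly, coeff_bitPoly]
  split_ifs with h
  · simp [Nat.div_eq_of_lt h]
  · have : 1 - l / d = 0 := by
      have := (Nat.one_le_div_iff hd).2 (not_lt.1 h)
      omega
    simp [this]

theorem eval_bitExpr {μ : Memory} (h : Static p k d C coins μ) {b t : ℕ} (ht : t < k)
    (hb : μ 13 0 = b) (hμt : μ 9 0 = t) : bitExpr.eval μ = b / 2 ^ t % 2 := by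
  simp only [bitExpr, Expr.eval, Op.eval, hb, hμt, h.pow t ht.le]

theorem wp_signLoop (hp : p.Prime) (hM : LargeBound p k d C M) {σ : State}
    (hσ : Static p k d C coins σ.mem) {b : ℕ} (hb : σ.mem 13 0 = b) :
    Wp M ((k + 1) * 300) signLoop σ (fun τ => τ.mem 14 0 = (subsetSign p k b).val) := by
  have : Fact p.Prime := ⟨hp⟩
  have : Fact (1 < p) := ⟨hp.one_lt⟩
  have hpM := hM.prime
  refine wp_seq (n₁ := 10) (n₂ := (k + 1) * 280) (R := fun τ => τ.mem 14 0 = 1)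
    (wp_set (by decide) (by simp only [Expr.eval]; have := hp.one_lt; omega)
      (by simp [Expr.eval, Memory.write_apply])) ?_ (by omega)
  intro τ hτ h14
  replace hτ : σ.mem.AgreeOff [9, 14] τ.mem := hτ.mono (by decide)
  refine wp_forLoop (n := k) (c := 200)
    (fun j ρ => ρ.mem 14 0 = (subsetSign p j b).val) (by decide) hM.rounds
    (fun j ρ x h => by simpa [Memory.write_apply] using h)
    (by simp [h14, subsetSign, ZMod.val_one])
    (fun ρ hρ => ?_) ?_ (Nat.mul_le_mul_left _ (by decide))
  · exact (hσ.of_agreeOff (hτ.trans (hρ.mono (l' := [9, 14]) (by decide))) (by decide)).degree_eq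
  · intro j hj ρ hI hρj hρ
    have hag := hτ.trans (hρ.mono (l' := [9, 14]) (by decide))
    have hst := hσ.of_agreeOff hag (by decide)
    have hbit := eval_bitExpr hst hj (by rw [hag 13 (by decide), hb]) hρj
    have hval : ((Expr.var 14 *ₑ (.lit 1 +ₑ bitExpr *ₑ (.var 0 -ₑ .lit 2))) %ₑ .var 0).eval ρ.mem =
        (subsetSign p (j + 1) b).val := by
      simp only [Expr.eval, Op.eval, hbit, hst.prime_eq, hI]
      rw [← ZMod.val_natCast]
      congr 1
      rw [show subsetSign p (j + 1) b = subsetSign p j b * _ from Finset.prod_range_succ _ _]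
      -- The program writes `p - 2` for `-2`; the truncated subtraction is exact because `2 ≤ p`.
      push_cast [Nat.cast_sub hp.two_le]
      rw [ZMod.natCast_zmod_val, ZMod.natCast_self]
      ring
    refine wp_set (by decide) ?_ ?_
    · rw [hval]; exact (ZMod.val_lt _).le.trans hpM
    · simp only [hval]; simp [Expr.eval, Memory.write_apply]

theorem wp_inputLoop (hp : p.Prime) (hd : 0 < d) (hM : LargeBound p k d C M) {σ : State}
    (hσ : Static p k d C coins σ.mem) {b : ℕ} (hb : σ.mem 13 0 = b) :
    Wp M ((n + 1) * ((k * d + 2) * ((k + 1) * 2000) + 50)) inputLoop σ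
      (RowsCorrect p k d C coins b n ·.mem) := by
  have : Fact p.Prime := ⟨hp⟩
  have hnodes := hM.nodes
  refine wp_forLoop (n := n) (c := (k * d + 2) * ((k + 1) * 2000))
    (fun j ρ => RowsCorrect p k d C coins b j ρ.mem) (by decide) (by omega)
    (fun j ρ x h => by simpa [Memory.write_apply, RowsCorrect] using h)
    (fun i' hi' => absurd hi' (Nat.not_lt_zero _)) (fun ρ hρ => ?_) ?_
    (Nat.mul_le_mul_left _ (Nat.add_le_add_left (by decide) _))
  · exact (hσ.of_agreeOff hρ (by decide)).arity_eq
  · intro i hi ρ hI hρi hρ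
    have hst := hσ.of_agreeOff hρ (by decide)
    refine (wp_fillRow (r := i) (B := k) (W := 500) (fun _ => k)
      (fun l t => b / 2 ^ t % 2 * (coins ((i * k + t) * d + l)).toNat * (1 - l / d))
      hM.len hM.rounds (fun _ _ => le_rfl) hp.pos hM.prime hst.prime_eq hst.len ?_ ?_ ?_
      (by decide) (by decide) (by decide) (Nat.mul_le_mul_left _ (Nat.mul_le_mul_left _ (by decide)))).mono
      le_rfl ?_
    · intro μ hμ
      simp only [Expr.eval]
      rw [hμ 11 (by decide), hρi]
    · intro l hl μ hμ _
      exact (hst.of_agreeOff hμ (by decide)).degree_eq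
    · intro l hl t ht μ hμ _ hμl hμt
      have hst' := hst.of_agreeOff hμ (by decide)
      have hbit := eval_bitExpr (b := b) hst' ht
        (by rw [hμ 13 (by decide), hρ 13 (by decide), hb]) hμt
      have h11 : μ 11 0 = i := by rw [hμ 11 (by decide), hρi]
      simp only [inputTerm, Expr.eval, Op.eval, hbit, hμl, hμt, hst'.deg, hst'.degree_eq, h11]
      by_cases hld : l < d
      · rw [hst'.coin]
        have h1 : i * k + t + 1 ≤ n * k := by
          have := Nat.mul_le_mul_right k (Nat.succ_le_of_lt hi)
          rw [Nat.succ_mul] at this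
          omega
        have h2 := Nat.mul_le_mul_right d h1
        rw [Nat.succ_mul] at h2
        omega
      · have : 1 - l / d = 0 := by
          have := (Nat.one_le_div_iff hd).2 (not_lt.1 hld)
          omega
        rw [this, mul_zero, mul_zero]
    · intro τ _ hτ i' hi' l hl
      rcases Nat.lt_succ_iff_lt_or_eq.1 hi' with h | rfl
      · rw [hτ.2, hI i' h l hl]
        have := Nat.mul_le_mul_right (k * d + 1) (Nat.succ_le_of_lt h)
        rw [Nat.succ_mul] at this
        omega
      · rw [hτ.1 l hl, ← ZMod.val_natCast, ← coeff_subsetPoint b i' l hd, nodeValue,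
          C.nodePolys_getD_var _ i' hi, MvPolynomial.aeval_X]

end

/-! ### Evaluation of the gates -/

section
variable {p k d n : ℕ} {C : Circuit n} {coins : ℕ → Bool} {M : ℕ}

theorem sum_map_eq_sum_range {R : Type*} [AddCommMonoid R] (l : List ℕ) (f : ℕ → R) :
    (l.map f).sum = ∑ t ∈ Finset.range l.length, f (l.getD t 0) := by
  induction l with
  | nil => simp
  | cons a l ih => simp [Finset.sum_range_succ', ih, add_comm]

theorem coeff_nodeValue_add (b l : ℕ) {j : ℕ} (hj : j < C.gates.length) {L : List ℕ} {hL : L.Nodup}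
    (h : C.gates[j] = .add L hL) : (nodeValue p k d C coins b (n + j)).coeff l =
      ∑ t ∈ Finset.range L.length, (nodeValue p k d C coins b (L.getD t 0)).coeff l := by
  rw [nodeValue, C.nodePolys_getD_gate _ j hj, h, Gate.value, sum_map_eq_sum_range, map_sum,
    Polynomial.finsetSum_coeff]
  rfl

/-- Coefficient `l` of a product involves only coefficients up to `l`. Hence keeping `k * d + 1`
coefficients per node is exact, even at inner nodes of much larger degree. -/
theorem coeff_nodeValue_mul (b l : ℕ) {j : ℕ} (hj : j < C.gates.length) {x y : ℕ}
    (h : C.gates[j] = .mul x y) : (nodeValue p k d C coins b (n + j)).coeff l =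
      ∑ t ∈ Finset.range (l + 1), (nodeValue p k d C coins b x).coeff t *
        (nodeValue p k d C coins b y).coeff (l - t) := by
  rw [nodeValue, C.nodePolys_getD_gate _ j hj, h, Gate.value, map_mul, Polynomial.coeff_mul]
  exact Finset.Nat.sum_antidiagonal_eq_sum_range_succ
    (fun i i' => (nodeValue p k d C coins b x).coeff i * (nodeValue p k d C coins b y).coeff i') l

theorem row_index_lt {x r N l : ℕ} (hx : x < r) (hl : l < N) : x * N + l < r * N := by
  have := Nat.mul_le_mul_right N (Nat.succ_le_of_lt hx)
  rw [Nat.succ_mul] at this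
  omega

theorem RowsCorrect.succ {b r : ℕ} {μ ν : Memory} (h : RowsCorrect p k d C coins b r μ)
    (hν : ∀ c < r * (k * d + 1), ν 3 c = μ 3 c)
    (hr : ∀ l < k * d + 1, ν 3 (r * (k * d + 1) + l) = ((nodeValue p k d C coins b r).coeff l).val) :
    RowsCorrect p k d C coins b (r + 1) ν := by
  intro i hi l hl
  rcases Nat.lt_succ_iff_lt_or_eq.1 hi with h' | rfl
  · rw [hν _ (row_index_lt h' hl), h i h' l hl]
  · exact hr l hl

theorem wp_gateStep (hp : p.Prime) (hM : LargeBound p k d C M) {σ : State}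
    (hσ : Static p k d C coins σ.mem) {b j : ℕ} (hj : j < C.size) (h11 : σ.mem 11 0 = j)
    (h12 : σ.mem 12 0 = C.gatePos j) (hrows : RowsCorrect p k d C coins b (n + j) σ.mem) :
    Wp M ((k * d + 2) * ((n + C.size + k * d + 2) * 2000) + 200) gateStep σ (fun τ =>
      RowsCorrect p k d C coins b (n + j + 1) τ.mem ∧ τ.mem 12 0 = C.gatePos (j + 1)) := by
  have : Fact p.Prime := ⟨hp⟩
  have hj' : j < C.gates.length := hj
  have hpos := C.gatePos_succ j hj'
  have hposM := (C.gatePos_le p k (j + 1)).trans hM.input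
  have hent : ∀ q < C.gates[j].encode.length, ∀ μ : Memory, μ 0 = σ.mem 0 →
      μ 0 (C.gatePos j + q) = C.gates[j].encode.getD q 0 := by
    intro q hq μ hμ
    rw [hμ, hσ.input, C.encodeInput_getD p k j q hj' hq]
  have hcost : ∀ B, B ≤ n + C.size + k * d + 1 → (k * d + 1 + 1) * ((B + 1) * (3 * 500 + 200)) ≤
      (k * d + 2) * ((n + C.size + k * d + 2) * 2000) := fun B hB =>
    Nat.mul_le_mul_left _ (Nat.mul_le_mul (by omega) (by omega))
  have hac := C.acyclic j hj'
  match hgate : C.gates[j] with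
  | .mul x y =>
    simp only [hgate, Gate.encode, List.length_cons, List.length_nil] at hent hpos
    have e0 := hent 0 (by omega) σ.mem rfl
    have hx : x < n + j := hac x (by simp [hgate, Gate.inputs])
    have hy : y < n + j := hac y (by simp [hgate, Gate.inputs])
    refine wp_ite (m := (k * d + 2) * ((n + C.size + k * d + 2) * 2000) + 100) (fun _ => ?_) (fun h => ?_) (by
      have : (gateEntry 0).weight + 1 ≤ 100 := by decide
      omega)
    · refine wp_seq (n₂ := 100) (wp_fillRow (r := n + j) (B := k * d + 1) (W := 500) (fun l => l + 1)
        (fun l t => ((nodeValue p k d C coins b x).coeff t).val *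
          ((nodeValue p k d C coins b y).coeff (l - t)).val)
        hM.len hM.len (fun l hl => hl) hp.pos hM.prime hσ.prime_eq hσ.len ?_ ?_ ?_
        (by decide) (by decide) (by decide) (hcost _ (by omega))) ?_ le_rfl
      · intro μ hμ
        simp only [gateRow, Expr.eval, Op.eval]
        rw [hμ 0 (by decide), hσ.arity_eq, hμ 11 (by decide), h11]
      · intro l _ μ _ hμl
        simp only [Expr.eval, Op.eval, hμl]
      · intro l hl t ht μ hμ hμ3 hμl hμt
        have h0 := hμ 0 (by decide)
        have e1 := hent 1 (by omega) μ h0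
        have e2 := hent 2 (by omega) μ h0
        simp only [List.getD_cons_succ, List.getD_cons_zero] at e1 e2
        have e7 : μ 7 0 = k * d + 1 := by rw [hμ 7 (by decide), hσ.len]
        have e12 : μ 12 0 = C.gatePos j := by rw [hμ 12 (by decide), h12]
        simp only [mulTerm, gateEntry, Expr.eval, Op.eval, e12, e1, e2, e7, hμl, hμt]
        rw [hμ3 _ (row_index_lt hx (by omega)), hμ3 _ (row_index_lt hy (by omega)),
          hrows x hx t (by omega), hrows y hy (l - t) (by omega)]
      · intro τ hτ hτ3
        have hptr : (Expr.var 12 +ₑ .lit 3).eval τ.mem = C.gatePos (j + 1) := by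
          simp only [Expr.eval, Op.eval, hτ 12 (by simp [fillRow, forLoop, sumLoop, Program.writes]), h12, hpos]
        refine wp_set (by decide) (by rw [hptr]; exact hposM) ?_
        simp only [hptr]
        refine ⟨RowsCorrect.succ hrows (fun c hc => ?_) (fun l hl => ?_), by
          simp [Expr.eval, Memory.write_apply]⟩
        · rw [Memory.write_of_ne (by decide), hτ3.2 c hc]
        · rw [Memory.write_of_ne (by decide), hτ3.1 l hl, ← ZMod.val_natCast,
            coeff_nodeValue_mul b l hj' hgate]
          simp
    -- The description of a `×` gate starts with `1`, so the other branch is not taken.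
    · exfalso
      simp only [gateEntry, Expr.eval, Op.eval, h12, e0, List.getD_cons_zero] at h
      omega
  | .add L hL =>
    simp only [hgate, Gate.encode, List.length_cons] at hent hpos
    have e0 := hent 0 (by omega) σ.mem rfl
    have hlen := Gate.length_inputs_le C j hj' L hL hgate
    have hnodes := hM.nodes
    have hin : ∀ t < L.length, L.getD t 0 < n + j := fun t ht => by
      rw [List.getD_eq_getElem _ _ ht]
      exact hac _ (by rw [hgate]; exact List.getElem_mem ht)
    refine wp_ite (m := (k * d + 2) * ((n + C.size + k * d + 2) * 2000) + 100) (fun h => ?_) (fun _ => ?_) (by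
      have : (gateEntry 0).weight + 1 ≤ 100 := by decide
      omega)
    · exfalso
      simp only [gateEntry, Expr.eval, Op.eval, h12, e0, List.getD_cons_zero] at h
      omega
    · refine wp_seq (n₂ := 100) (wp_fillRow (r := n + j) (B := n + C.size) (W := 500) (fun l => L.length)
        (fun l t => ((nodeValue p k d C coins b (L.getD t 0)).coeff l).val)
        -- The number of summands is the fan-in, bounded by the number of nodes.
        hM.len hnodes (fun l hl => by omega) hp.pos hM.prime hσ.prime_eq hσ.len ?_ ?_ ?_
        (by decide) (by decide) (by decide) (hcost _ (by omega))) ?_ le_rfl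
      · intro μ hμ
        simp only [gateRow, Expr.eval, Op.eval]
        rw [hμ 0 (by decide), hσ.arity_eq, hμ 11 (by decide), h11]
      · intro l _ μ hμ hμl
        have e1 := hent 1 (by omega) μ (hμ 0 (by decide))
        simp only [gateEntry, Expr.eval, Op.eval, hμ 12 (by decide), h12, e1]
        rfl
      · intro l hl t ht μ hμ hμ3 hμl hμt
        have h0 := hμ 0 (by decide)
        have e2 := hent (2 + t) (by omega) μ h0
        have e7 : μ 7 0 = k * d + 1 := by rw [hμ 7 (by decide), hσ.len]
        have e12 : μ 12 0 = C.gatePos j := by rw [hμ 12 (by decide), h12]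
        rw [← add_assoc, show (0 :: L.length :: L).getD (2 + t) 0 = L.getD t 0 by
          rw [show 2 + t = t + 1 + 1 by omega, List.getD_cons_succ, List.getD_cons_succ]] at e2
        simp only [addTerm, Expr.eval, Op.eval, e12, e2, e7, hμl, hμt]
        rw [hμ3 _ (row_index_lt (hin t ht) hl), hrows _ (hin t ht) l hl]
      · intro τ hτ hτ3
        have hptr : (Expr.var 12 +ₑ .lit 2 +ₑ gateEntry 1).eval τ.mem = C.gatePos (j + 1) := by
          have e1 := hent 1 (by omega) τ.mem (hτ 0 (by simp [fillRow, forLoop, sumLoop, Program.writes]))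
          simp only [gateEntry, Expr.eval, Op.eval,
            hτ 12 (by simp [fillRow, forLoop, sumLoop, Program.writes]), h12, hpos, e1]
          simp only [List.getD_cons_succ, List.getD_cons_zero]
          omega
        refine wp_set (by decide) (by rw [hptr]; exact hposM) ?_
        simp only [hptr]
        refine ⟨RowsCorrect.succ hrows (fun c hc => ?_) (fun l hl => ?_), by
          simp [Expr.eval, Memory.write_apply]⟩
        · rw [Memory.write_of_ne (by decide), hτ3.2 c hc]
        · rw [Memory.write_of_ne (by decide), hτ3.1 l hl, ← ZMod.val_natCast,
            coeff_nodeValue_add b l hj' hgate]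
          simp

theorem wp_gateLoop (hp : p.Prime) (hM : LargeBound p k d C M) {σ : State}
    (hσ : Static p k d C coins σ.mem) {b : ℕ} (hrows : RowsCorrect p k d C coins b n σ.mem) :
    Wp M ((C.size + 1) * ((k * d + 2) * ((n + C.size + k * d + 2) * 2000) + 300)) gateLoop σ
      (fun τ => RowsCorrect p k d C coins b (n + C.size) τ.mem) := by
  have hnodes := hM.nodes
  have h5 : C.gatePos 0 = 5 := by simp [Circuit.gatePos]
  refine wp_seq (n₁ := 20) (n₂ := (C.size + 1) * ((k * d + 2) * ((n + C.size + k * d + 2) * 2000) + 280))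
    (R := fun τ => RowsCorrect p k d C coins b (n + 0) τ.mem ∧ τ.mem 12 0 = C.gatePos 0)
    (wp_set (by decide) ?_ ?_) ?_ ?_
  · simp only [Expr.eval, ← h5]
    exact (C.gatePos_le p k 0).trans hM.input
  · refine ⟨?_, by simp [Expr.eval, Memory.write_apply, h5]⟩
    simpa [Memory.write_apply, RowsCorrect] using hrows
  · intro τ hτ hτR
    have hst := hσ.of_agreeOff hτ (by decide)
    refine Wp.mono (wp_forLoop (n := C.size)
      (c := (k * d + 2) * ((n + C.size + k * d + 2) * 2000) + 200)
      (fun j ρ => RowsCorrect p k d C coins b (n + j) ρ.mem ∧ ρ.mem 12 0 = C.gatePos j)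
      (by decide) (by omega) (fun j ρ x h => by simpa [Memory.write_apply, RowsCorrect] using h) hτR
      (fun ρ hρ => (hst.of_agreeOff hρ (by decide)).size_eq) (fun j hj ρ hI hρj hρ => ?_) le_rfl)
      (Nat.mul_le_mul_left _ ?_) (fun ρ _ h => h.1)
    · exact wp_gateStep hp hM (hst.of_agreeOff hρ (by decide)) hj hρj hI.2 hI.1
    · rw [add_assoc]
      exact Nat.add_le_add_left (by decide) _
  · have := Nat.le_mul_of_pos_left 20 (Nat.succ_pos C.size)
    simp only [Nat.succ_eq_add_one] at this
    nlinarith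

end

/-! ### Summation over the subsets and the complete program -/

section
variable {p k d n : ℕ} {C : Circuit n} {coins : ℕ → Bool} {M : ℕ}

variable (p k d C coins) in
/-- A coefficient of the signed sum of the values for the first `m` subsets. -/
noncomputable def partialSum (m l : ℕ) : ZMod p :=
  ∑ b ∈ Finset.range m, subsetSign p k b * (nodeValue p k d C coins b C.out).coeff l

theorem wp_accumulateLoop (hp : p.Prime) (hM : LargeBound p k d C M) {σ : State}
    (hσ : Static p k d C coins σ.mem) {b : ℕ} (h14 : σ.mem 14 0 = (subsetSign p k b).val)
    (hrows : RowsCorrect p k d C coins b (n + C.size) σ.mem)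
    (h4 : ∀ l < k * d + 1, σ.mem 4 l = (partialSum p k d C coins b l).val) :
    Wp M ((k * d + 2) * 300) accumulateLoop σ (fun τ =>
      ∀ l < k * d + 1, τ.mem 4 l = (partialSum p k d C coins (b + 1) l).val) := by
  have : Fact p.Prime := ⟨hp⟩
  -- The update is in place: entries below `j` are new, the others still hold the sum of the earlier
  -- rounds.
  refine (wp_forLoop (n := k * d + 1) (c := 200) (fun j ρ =>
    (∀ l < j, ρ.mem 4 l = (partialSum p k d C coins (b + 1) l).val) ∧
      ∀ l, j ≤ l → ρ.mem 4 l = σ.mem 4 l) (by decide) hM.len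
    (fun j ρ x h => by simpa [Memory.write_apply] using h) ⟨by simp, fun _ _ => rfl⟩
    (fun ρ hρ => ?_) ?_ (Nat.mul_le_mul_left _ (by decide))).mono le_rfl (fun τ _ h => h.1)
  · exact (hσ.of_agreeOff hρ (by decide)).len
  intro l hl ρ hI hρl hρ
  have hst := hσ.of_agreeOff hρ (by decide)
  have hval : ((Expr.get 4 (.var 10) +ₑ .var 14 *ₑ .get 3 (.get 0 (.lit 4) *ₑ .var 7 +ₑ .var 10)) %ₑ
      .var 0).eval ρ.mem = (partialSum p k d C coins (b + 1) l).val := by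
    simp only [Expr.eval, Op.eval, hρl, hst.prime_eq, hst.out_eq, hst.len, hI.2 l le_rfl,
      hρ 14 (by decide), hρ 3 (by decide), h14, hrows C.out C.out_lt l hl, h4 l hl]
    rw [← ZMod.val_natCast]
    congr 1
    simp [partialSum, Finset.sum_range_succ]
  refine wp_set (by decide) ?_ ?_
  · rw [hval]; exact (ZMod.val_lt _).le.trans hM.prime
  · simp only [hval]
    simp only [Expr.eval, hρl]
    refine ⟨fun l' hl' => ?_, fun l' hl' => ?_⟩
    · rw [Memory.write_apply]
      rcases Nat.lt_succ_iff_lt_or_eq.1 hl' with h | rfl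
      · rw [if_neg (by omega), hI.1 _ h]
      · rw [if_pos ⟨rfl, rfl⟩]
    · rw [Memory.write_apply, if_neg (by omega), hI.2 l' (by omega)]

variable (k d C) in
/-- A bound for the cost of the evaluation of the circuit for one subset. -/
def roundCost : ℕ :=
  (k + 1) * 300 + ((n + 1) * ((k * d + 2) * ((k + 1) * 2000) + 50) +
    ((C.size + 1) * ((k * d + 2) * ((n + C.size + k * d + 2) * 2000) + 300) + (k * d + 2) * 300))

theorem wp_subsetLoop (hp : p.Prime) (hd : 0 < d) (hM : LargeBound p k d C M) {σ : State}
    (hσ : Static p k d C coins σ.mem) (h4 : ∀ l, σ.mem 4 l = 0) :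
    Wp M ((2 ^ k + 1) * (roundCost k d C + 100)) subsetLoop σ (fun τ =>
      ∀ l < k * d + 1, τ.mem 4 l = (partialSum p k d C coins (2 ^ k) l).val) := by
  refine wp_forLoop (n := 2 ^ k) (c := roundCost k d C) (fun j ρ =>
    ∀ l < k * d + 1, ρ.mem 4 l = (partialSum p k d C coins j l).val) (by decide) hM.pow
    (fun j ρ x h => by simpa [Memory.write_apply] using h) (by simp [partialSum, h4])
    (fun ρ hρ => ?_) ?_ (Nat.mul_le_mul_left _ (Nat.add_le_add_left (by decide) _))
  · have hst := hσ.of_agreeOff hρ (by decide)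
    simp only [Expr.eval, hst.degree_eq, hst.pow k le_rfl]
  intro b hb ρ hI hρb hρ
  have hst := hσ.of_agreeOff hρ (by decide)
  refine wp_seq (wp_signLoop hp hM hst hρb) (fun ρ₁ hρ₁ h14 => ?_) le_rfl
  have hst₁ := hst.of_agreeOff hρ₁ (by decide)
  refine wp_seq (wp_inputLoop hp hd hM hst₁ (by rw [hρ₁ 13 (by decide), hρb]))
    (fun ρ₂ hρ₂ hrows => ?_) le_rfl
  have hst₂ := hst₁.of_agreeOff hρ₂ (by decide)
  refine wp_seq (wp_gateLoop hp hM hst₂ hrows) (fun ρ₃ hρ₃ hrows' => ?_) le_rfl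
  have hst₃ := hst₂.of_agreeOff hρ₃ (by decide)
  refine wp_accumulateLoop hp hM hst₃ ?_ hrows' ?_
  · rw [hρ₃ 14 (by decide), hρ₂ 14 (by decide), h14]
  · rw [hρ₃ 4 (by decide), hρ₂ 4 (by decide), hρ₁ 4 (by decide)]
    exact hI

theorem wp_answerLoop (hM : LargeBound p k d C M) (hM1 : 1 ≤ M) {σ : State}
    (h7 : σ.mem 7 0 = k * d + 1) (h1 : σ.mem 1 0 = 0) :
    Wp M ((k * d + 2) * 100) answerLoop σ (fun τ =>
      τ.mem 1 0 = if ∃ l < k * d + 1, σ.mem 4 l ≠ 0 then 1 else 0) := by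
  classical
  refine (wp_forLoop (n := k * d + 1) (c := 60) (fun j ρ =>
    ρ.mem 1 0 = if ∃ l < j, σ.mem 4 l ≠ 0 then 1 else 0) (by decide) hM.len
    (fun j ρ x h => by simpa [Memory.write_apply] using h) (by simpa using h1)
    (fun ρ hρ => ?_) ?_ (Nat.mul_le_mul_left _ (by decide))).mono le_rfl (fun τ _ h => by convert h)
  · simp only [Expr.eval, hρ 7 (by decide), h7]
  intro j hj ρ hI hρj hρ
  have hval : (Expr.get 4 (.var 10)).eval ρ.mem = σ.mem 4 j := by
    simp only [Expr.eval, hρj, hρ 4 (by decide)]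
  refine wp_ite (m := 20) (fun h => ?_) (fun h => ?_) (by decide)
  · rw [hval] at h
    refine wp_set (by decide) hM1 ?_
    rw [if_pos ⟨j, Nat.lt_succ_self j, h⟩]
    simp [Expr.eval, Memory.write_apply]
  · rw [hval] at h
    refine wp_skip (by decide) ?_
    rw [hI]
    congr 1
    refine propext ⟨fun ⟨l, hl, h'⟩ => ⟨l, by omega, h'⟩, fun ⟨l, hl, h'⟩ => ⟨l, ?_, h'⟩⟩
    rcases Nat.lt_succ_iff_lt_or_eq.1 hl with hl | rfl
    · exact hl
    · exact absurd h h'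

theorem wp_flipLoop (hM : LargeBound p k d C M) (hM1 : 1 ≤ M) {σ : State} (hk : σ.mem 0 1 = k)
    (hn : σ.mem 0 2 = n) (hd : σ.mem 6 0 = d) :
    Wp M ((n * k * d + 1) * 300) flipLoop σ (fun τ =>
      ∀ c < n * k * d, τ.mem 2 c = (σ.coins c).toNat) := by
  refine (wp_forLoop (n := n * k * d) (c := 100) (fun j ρ =>
    (∀ c < j, ρ.mem 2 c = (σ.coins c).toNat) ∧ ∀ c, ρ.coins c = σ.coins (c + j)) (by decide) hM.coin
    (fun j ρ x h => by simpa [Memory.write_apply] using h) ⟨by simp, fun _ => rfl⟩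
    (fun ρ hρ => ?_) ?_ (Nat.mul_le_mul_left _ (by decide))).mono le_rfl (fun τ _ h => h.1)
  · simp only [Expr.eval, Op.eval, hρ 0 (by decide), hρ 6 (by decide), hk, hn, hd]
  intro j hj ρ hI hρj hρ
  refine wp_flip (by decide) hM1 ⟨fun c hc => ?_, fun c => ?_⟩
  · simp only [Expr.eval, hρj]
    rw [Memory.write_apply]
    rcases Nat.lt_succ_iff_lt_or_eq.1 hc with h | rfl
    · rw [if_neg (by omega), hI.1 _ h]
    · rw [if_pos ⟨rfl, rfl⟩, hI.2, zero_add]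
  · simp only [hI.2]
    congr 1
    omega

/-- With the powers of two tabulated, a binary digit of a subset number costs one division and one
remainder. -/
theorem wp_powerLoop (hM : LargeBound p k d C M) {σ : State} (hk : σ.mem 0 1 = k) :
    Wp M ((k + 1) * 200) powerLoop σ (fun τ => ∀ j ≤ k, τ.mem 5 j = 2 ^ j) := by
  have hM1 : 1 ≤ M := Nat.one_le_two_pow.trans hM.pow
  refine wp_seq (n₁ := 20) (n₂ := (k + 1) * 180) (R := fun τ => ∀ j ≤ 0, τ.mem 5 j = 2 ^ j)
    (wp_set (by decide) hM1 (by simp [Expr.eval, Memory.write_apply])) ?_ (by omega)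
  intro τ hτ h5
  refine wp_forLoop (n := k) (c := 100) (fun i ρ => ∀ j ≤ i, ρ.mem 5 j = 2 ^ j) (by decide) hM.rounds
    (fun j ρ x h => by simpa [Memory.write_apply] using h) h5 (fun ρ hρ => ?_) ?_
    (Nat.mul_le_mul_left _ (by decide))
  · simp only [Expr.eval, hρ 0 (by decide), hτ 0 (by decide), hk]
  intro i hi ρ hI hρi hρ
  have hval : (Expr.lit 2 *ₑ .get 5 (.var 15)).eval ρ.mem = 2 ^ (i + 1) := by
    simp only [Expr.eval, Op.eval, hρi, hI i le_rfl, pow_succ, mul_comm]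
  refine wp_set (by decide) ?_ ?_
  · rw [hval]; exact (Nat.pow_le_pow_right two_pos hi).trans hM.pow
  · simp only [hval]
    simp only [Expr.eval, Op.eval, hρi]
    intro j hj
    rw [Memory.write_apply]
    rcases Nat.le_succ_iff.1 hj with h | rfl
    · rw [if_neg (by omega), hI j h]
    · rw [if_pos ⟨rfl, rfl⟩]

/-- A bound for the cost of the test. -/
def testCost (e k d : ℕ) {n : ℕ} (C : Circuit n) : ℕ :=
  (300 + 50 * (e + 1).size) + ((n * k * d + 1) * 300 + ((k + 1) * 200 +
    ((2 ^ k + 1) * (roundCost k d C + 100) + (k * d + 2) * 100)))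

theorem wp_testProgram (e : ℕ) (hp : p.Prime) (hd : d = (e + 1) * (n + k + C.size + 2))
    (hM : LargeBound p k d C M) :
    Wp M (testCost e k d C) (testProgram e) (initState (encodeInput p k C) coins) (fun τ =>
      τ.mem 1 0 = if ∃ l < k * d + 1, partialSum p k d C coins (2 ^ k) l ≠ 0 then 1 else 0) := by
  have hM1 : 1 ≤ M := Nat.one_le_two_pow.trans hM.pow
  have hd0 : 0 < d := by rw [hd]; positivity
  set σ := initState (encodeInput p k C) coins with hσ
  have hin : ∀ i, σ.mem 0 i = (encodeInput p k C).getD i 0 := fun i => rfl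
  have hzero : ∀ a i, a ≠ 0 → σ.mem a i = 0 := fun a i ha => if_neg ha
  have hk : σ.mem 0 1 = k := rfl
  have hn : σ.mem 0 2 = n := rfl
  have hs : σ.mem 0 3 = C.size := rfl
  -- The size of `e + 1` enters because this number is a literal of the program.
  refine wp_seq (n₁ := 300 + 50 * (e + 1).size)
    (R := fun τ => τ.mem 6 0 = d ∧ τ.mem 7 0 = k * d + 1 ∧ τ.coins = coins) ?_ (fun τ hτ hR => ?_) le_rfl
  · refine wp_seq (n₁ := 200 + 50 * (e + 1).size) (n₂ := 100)
      (R := fun τ => τ.mem 6 0 = d ∧ τ.coins = coins) (wp_set ?_ ?_ ?_) (fun τ hτ hR => ?_) (by omega)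
    · simp only [setWeight, Expr.weight, Expr.valueWeight, Nat.size_zero, Nat.size_one,
        show Nat.size 2 = 2 from rfl, show Nat.size 3 = 2 from rfl]
      omega
    · simp only [Expr.eval, Op.eval, hk, hn, hs, ← hd]
      exact hM.deg
    · simp only [Expr.eval, Op.eval, hk, hn, hs, ← hd]
      exact ⟨by simp [Memory.write_apply], rfl⟩
    · have h7 : (Expr.get 0 (.lit 1) *ₑ .var 6 +ₑ .lit 1).eval τ.mem = k * d + 1 := by
        simp only [Expr.eval, Op.eval, hτ 0 (by simp [Program.writes]), hR.1, hk]
      refine wp_set (by decide) (by rw [h7]; exact hM.len) ?_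
      simp only [h7]
      exact ⟨by simpa [Memory.write_apply] using hR.1, by simp [Expr.eval, Memory.write_apply], hR.2⟩
  replace hτ : σ.mem.AgreeOff [6, 7] τ.mem := hτ
  refine wp_seq (wp_flipLoop hM hM1 (by rw [hτ 0 (by decide), hk]) (by rw [hτ 0 (by decide), hn]) hR.1)
    (fun τ₁ hτ₁ hR₁ => ?_) le_rfl
  refine wp_seq (wp_powerLoop hM (by rw [hτ₁ 0 (by decide), hτ 0 (by decide), hk]))
    (fun τ₂ hτ₂ hR₂ => ?_) le_rfl
  have hst : Static p k d C coins τ₂.mem := by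
    refine ⟨fun i => ?_, fun c hc => ?_, hR₂, ?_, ?_⟩
    · rw [hτ₂ 0 (by decide), hτ₁ 0 (by decide), hτ 0 (by decide), hin]
    · rw [hτ₂ 2 (by decide), hR₁ c hc, hR.2.2]
    · rw [hτ₂ 6 (by decide), hτ₁ 6 (by decide), hR.1]
    · rw [hτ₂ 7 (by decide), hτ₁ 7 (by decide), hR.2.1]
  refine wp_seq (wp_subsetLoop hp hd0 hM hst fun l => ?_) (fun τ₃ hτ₃ hR₃ => ?_) le_rfl
  · rw [hτ₂ 4 (by decide), hτ₁ 4 (by decide), hτ 4 (by decide), hzero 4 l (by decide)]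
  · refine (wp_answerLoop hM hM1 (hst.of_agreeOff hτ₃ (by decide)).len ?_).mono le_rfl
      fun ρ _ h => h.trans ?_
    · rw [hτ₃ 1 (by decide), hτ₂ 1 (by decide), hτ₁ 1 (by decide), hτ 1 (by decide),
        hzero 1 0 (by decide)]
    · have : NeZero p := ⟨hp.ne_zero⟩
      congr 1
      refine propext (exists_congr fun l => and_congr_right fun hl => ?_)
      rw [hR₃ l hl, Ne, ZMod.val_eq_zero]

end

/-! ### Correctness and running time -/

theorem coinProb_mono {T : ℕ} {A B : (Fin T → Bool) → Prop} (h : ∀ r, A r → B r) :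
    coinProb T A ≤ coinProb T B := by
  classical
  unfold coinProb
  refine div_le_div_of_nonneg_right (Nat.cast_le.2 (Finset.card_le_card fun r hr => ?_)) (by positivity)
  simp only [Finset.mem_filter, Finset.mem_univ, true_and] at hr ⊢
  exact h r hr

theorem coinProb_true (T : ℕ) : coinProb T (fun _ => True) = 1 := by
  simp [coinProb]

section
variable {p k d n : ℕ} {C : Circuit n} {coins : ℕ → Bool}

variable (p k d C coins) in
/-- The alternating sum for the matrix given by the coins. -/
noncomputable def coinSum : Polynomial (ZMod p) :=
  alternatingSum (C.poly (ZMod p)) fun (i : Fin n) (j : Fin k) =>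
    coinPoly (ZMod p) d coins (i * k + j)

theorem partialSum_eq_coeff (l : ℕ) :
    partialSum p k d C coins (2 ^ k) l = (coinSum p k d C coins).coeff l := by
  rw [coinSum, alternatingSum_eq_sum_range (C.poly (ZMod p))
    (fun (i : Fin n) (j : ℕ) => coinPoly (ZMod p) d coins (i * k + j)), Polynomial.finsetSum_coeff]
  refine Finset.sum_congr rfl fun b _ => ?_
  have h : (∏ j ∈ Finset.range k, (1 - 2 * ((b / 2 ^ j % 2 : ℕ) : Polynomial (ZMod p)))) =
      Polynomial.C (subsetSign p k b) := by
    simp only [subsetSign, map_prod, map_sub, map_one, map_mul, map_ofNat, map_natCast]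
  rw [h, Polynomial.coeff_C_mul]
  rfl

/-- A nonzero sum has its leading coefficient among those stored, by the degree bound. -/
theorem exists_partialSum_ne_zero_iff (hk : (C.poly (ZMod p)).totalDegree ≤ k) :
    (∃ l < k * d + 1, partialSum p k d C coins (2 ^ k) l ≠ 0) ↔ coinSum p k d C coins ≠ 0 := by
  simp only [partialSum_eq_coeff]
  refine ⟨fun ⟨l, _, hl⟩ h0 => hl (by rw [h0, Polynomial.coeff_zero]), fun h => ?_⟩
  exact ⟨_, natDegree_alternatingSum_lt _ hk d coins, Polynomial.leadingCoeff_ne_zero.2 h⟩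

/-- This holds for all coins, so the test never errs when there is no such monomial. -/
theorem coinSum_eq_zero (hp : p.Prime) (hk : (C.poly (ZMod p)).totalDegree ≤ k)
    (h : ¬ HasMonomial p k (C.poly (ZMod p))) : coinSum p k d C coins = 0 := by
  have : Fact p.Prime := ⟨hp⟩
  rw [coinSum, alternatingSum_eq _ hk, coeff_aeval_linearForms_eq_zero _ hk h, mul_zero]

end

/-- Bounds for the parameters of the test by a power of `n + k + s + p`. -/
theorem parameter_bounds (e n k s p : ℕ) (hp : 2 ≤ p) :
    (n + k + s + p + 1 ≤ (n + k + s + p) ^ (e + 3)) ∧ e + 1 ≤ (n + k + s + p) ^ (e + 3) ∧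
    (e + 1) * (n + k + s + 2) ≤ (n + k + s + p) ^ (e + 3) ∧
    k * ((e + 1) * (n + k + s + 2)) + 2 ≤ (n + k + s + p) ^ (e + 3) ∧
    n * k * ((e + 1) * (n + k + s + 2)) ≤ (n + k + s + p) ^ (e + 3) := by
  set X := n + k + s + p with hX
  have hX2 : 2 ≤ X := by omega
  have he : e + 1 ≤ X ^ e := (Nat.lt_two_pow_self).trans_le (Nat.pow_le_pow_left hX2 e)
  have hd : (e + 1) * (n + k + s + 2) ≤ X ^ (e + 1) := by
    rw [pow_succ]
    exact Nat.mul_le_mul he (by omega)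
  have hpos : 1 ≤ X ^ e := Nat.one_le_pow _ _ (by omega)
  have h1 : X ^ (e + 1) * 2 ≤ X ^ (e + 2) := by
    rw [pow_succ X (e + 1)]; exact Nat.mul_le_mul_left _ hX2
  have h2 : X ^ (e + 2) * 2 ≤ X ^ (e + 3) := by
    rw [pow_succ X (e + 2)]; exact Nat.mul_le_mul_left _ hX2
  have h3 : X ≤ X ^ (e + 1) := by rw [pow_succ]; exact Nat.le_mul_of_pos_left _ hpos
  have h4 : X ^ e * 2 ≤ X ^ (e + 1) := by rw [pow_succ]; exact Nat.mul_le_mul_left _ hX2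
  have h5 : k * ((e + 1) * (n + k + s + 2)) ≤ X ^ (e + 2) := by
    rw [pow_succ X (e + 1), mul_comm]
    exact Nat.mul_le_mul hd (by omega)
  have h6 : n * k * ((e + 1) * (n + k + s + 2)) ≤ X ^ (e + 3) := by
    rw [pow_succ X (e + 2), mul_assoc, mul_comm]
    exact Nat.mul_le_mul h5 (by omega)
  refine ⟨by omega, by omega, by omega, by omega, h6⟩

/-- Cells must hold numbers up to `2 ^ k`, so `M` is exponential in `Z`; its word length is still
linear in `Z`. The input length is quadratic in `Z` and fits below `(Z + 1) ^ 3 ≤ 2 ^ (3 * Z)`. -/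
theorem largeBound_two_pow {n : ℕ} (C : Circuit n) (p k d Z : ℕ) (h1 : n + k + C.size + p + 1 ≤ Z)
    (hd : d ≤ Z) (hN : k * d + 2 ≤ Z) (hc : n * k * d ≤ Z) : LargeBound p k d C (2 ^ (4 * Z)) := by
  have hZ : Z ≤ 2 ^ Z := Nat.lt_two_pow_self.le
  have hZM : (2 ^ Z) ^ 3 ≤ 2 ^ (4 * Z) := by
    rw [← pow_mul]; exact Nat.pow_le_pow_right two_pos (by omega)
  have hZ3 : Z ^ 3 ≤ 2 ^ (4 * Z) := (Nat.pow_le_pow_left hZ 3).trans hZM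
  have hM : Z ≤ 2 ^ (4 * Z) := (Nat.le_self_pow (by decide) Z).trans hZ3
  refine ⟨by omega, Nat.pow_le_pow_right two_pos (by omega), by omega, by omega, by omega, ?_,
    by omega, by omega⟩
  refine (length_encodeInput_le C p k).trans (le_trans ?_ hZM)
  have hs : C.size * (n + C.size + 3) ≤ Z * (Z + 2) := Nat.mul_le_mul (by omega) (by omega)
  have hA : Z + 1 ≤ 2 ^ Z := Nat.lt_two_pow_self
  have hZ2 : 2 ≤ Z := by omega
  have hA3 := Nat.pow_le_pow_left hA 3
  have hexp : (Z + 1) ^ 3 = Z * Z * Z + 3 * (Z * Z) + 3 * Z + 1 := by ring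
  have hZZ : 4 ≤ Z * Z := Nat.mul_le_mul hZ2 hZ2
  have hmul : Z * (Z + 2) = Z * Z + 2 * Z := by ring
  omega

/-- Only the loop over the subsets is exponential; one round and all the remaining parts are cubic
in `Z`. -/
theorem testCost_le (e : ℕ) {n : ℕ} (C : Circuit n) (k d Z : ℕ) (h1 : n + k + C.size + 1 ≤ Z)
    (he : e + 1 ≤ Z) (hN : k * d + 2 ≤ Z) (hc : n * k * d ≤ Z) :
    testCost e k d C ≤ 2 ^ k * (20000 * Z ^ 3) := by
  have hZ : 1 ≤ Z := by omega
  have hZ2 : Z ≤ Z ^ 3 := Nat.le_self_pow (by decide) Z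
  have hsz : (e + 1).size ≤ Z := (Nat.size_le.2 Nat.lt_two_pow_self).trans he
  have hround : roundCost k d C ≤ 7000 * Z ^ 3 := by
    have a1 : (n + 1) * ((k * d + 2) * ((k + 1) * 2000) + 50) ≤ Z * (Z * (Z * 2000) + 50) :=
      Nat.mul_le_mul (by omega) (Nat.add_le_add_right
        (Nat.mul_le_mul hN (Nat.mul_le_mul_right _ (by omega))) _)
    have a2 : (C.size + 1) * ((k * d + 2) * ((n + C.size + k * d + 2) * 2000) + 300) ≤
        Z * (Z * (2 * Z * 2000) + 300) :=
      Nat.mul_le_mul (by omega) (Nat.add_le_add_right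
        (Nat.mul_le_mul hN (Nat.mul_le_mul_right _ (by omega))) _)
    have a3 : Z * (Z * (Z * 2000) + 50) = 2000 * Z ^ 3 + 50 * Z := by ring
    have a4 : Z * (Z * (2 * Z * 2000) + 300) = 4000 * Z ^ 3 + 300 * Z := by ring
    have a5 : (k + 1) * 300 ≤ Z * 300 := Nat.mul_le_mul_right _ (by omega)
    have a6 : (k * d + 2) * 300 ≤ Z * 300 := Nat.mul_le_mul_right _ hN
    unfold roundCost
    linarith
  have hpow : 1 ≤ 2 ^ k := Nat.one_le_two_pow
  have hmain : (2 ^ k + 1) * (roundCost k d C + 100) ≤ (2 ^ k * 2) * (7100 * Z ^ 3) :=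
    Nat.mul_le_mul (by omega) (by omega)
  have hrest : 2000 * Z ^ 3 ≤ 2 ^ k * (2000 * Z ^ 3) := Nat.le_mul_of_pos_left _ hpow
  have hsum : 2 ^ k * (20000 * Z ^ 3) =
      2 ^ k * 2 * (7100 * Z ^ 3) + 2 ^ k * (2000 * Z ^ 3) + 3800 * (2 ^ k * Z ^ 3) := by ring
  unfold testCost
  omega

/-- The exponent and the factor of the time bound. -/
def timeConstant (e : ℕ) : ℕ := 720000 + 5 * (e + 3)

theorem exists_exec (e p n k : ℕ) (hp : p.Prime) (C : Circuit n) (coins : ℕ → Bool) :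
    ∃ t τ, Exec (testProgram e) (initState (encodeInput p k C) coins) t τ ∧
      t ≤ timeConstant e * (n + k + C.size + p) ^ timeConstant e * p ^ k ∧
      τ.mem 1 0 = if ∃ l < k * ((e + 1) * (n + k + C.size + 2)) + 1,
        partialSum p k ((e + 1) * (n + k + C.size + 2)) C coins (2 ^ k) l ≠ 0 then 1 else 0 := by
  obtain ⟨h1, h2, h3, h4, h5⟩ := parameter_bounds e n k C.size p hp.two_le
  have hX : 1 ≤ n + k + C.size + p := by have := hp.two_le; omega
  set X := n + k + C.size + p
  set d := (e + 1) * (n + k + C.size + 2) with hd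
  set Z := X ^ (e + 3) with hZ
  have hZ1 : 1 ≤ Z := by omega
  have hM := largeBound_two_pow C p k d Z h1 h3 h4 h5
  obtain ⟨t, τ, hex, ht, -, hτ⟩ := wp_testProgram (coins := coins) e hp hd hM (by
    intro a i
    dsimp only [initState]
    split_ifs
    · refine (encodeInput_le C p k i).trans ((show _ ≤ Z by omega).trans ?_)
      exact (by omega : Z ≤ 4 * Z).trans Nat.lt_two_pow_self.le
    · exact Nat.zero_le _)
  refine ⟨t, τ, hex, ht.trans ?_, hτ⟩
  have hw : wordLength (2 ^ (4 * Z)) ≤ 6 * Z := by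
    rw [wordLength, Nat.size_pow]
    omega
  have harith : ∀ a b : ℕ, a * (20000 * b ^ 3) * (6 * b) ^ 2 = 720000 * b ^ 5 * a :=
    fun a b => by ring
  calc testCost e k d C * wordLength (2 ^ (4 * Z)) ^ 2
      ≤ (2 ^ k * (20000 * Z ^ 3)) * (6 * Z) ^ 2 :=
        Nat.mul_le_mul (testCost_le e C k d Z (by omega) h2 h4 h5) (Nat.pow_le_pow_left hw 2)
    _ = 720000 * Z ^ 5 * 2 ^ k := harith _ _
    _ ≤ timeConstant e * X ^ timeConstant e * p ^ k := by
        -- The rounds number `2 ^ k`; the base `p` enters only through `2 ≤ p`. As `Z = X ^ (e +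
        -- 3)`, the exponent needed is `5 * (e + 3)`, and `timeConstant e` dominates both it and the
        -- factor `720000 = 20000 * 36`.
        refine Nat.mul_le_mul (Nat.mul_le_mul ?_ ?_) (Nat.pow_le_pow_left hp.two_le k)
        · unfold timeConstant; omega
        · rw [hZ, ← pow_mul]
          exact Nat.pow_le_pow_right hX (by unfold timeConstant; omega)

/-- With `N = n + k + s + 2`, both `k ≤ N` and `N ≤ 2 ^ N` hold, so `k * N ^ e ≤ N ^ (e + 1) ≤ 2 ^
((e + 1) * N)`. -/
theorem div_two_pow_le (e n k s : ℕ) :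
    (k : ℝ) / 2 ^ ((e + 1) * (n + k + s + 2)) ≤ 1 / ((n : ℝ) + k + s + 2) ^ e := by
  rw [div_le_div_iff₀ (by positivity) (by positivity), one_mul]
  have h : k * (n + k + s + 2) ^ e ≤ 2 ^ ((e + 1) * (n + k + s + 2)) := by
    calc k * (n + k + s + 2) ^ e ≤ (n + k + s + 2) * (n + k + s + 2) ^ e :=
          Nat.mul_le_mul_right _ (by omega)
      _ = (n + k + s + 2) ^ (e + 1) := by ring
      _ ≤ (2 ^ (n + k + s + 2)) ^ (e + 1) := Nat.pow_le_pow_left Nat.lt_two_pow_self.le _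
      _ = _ := by rw [← pow_mul, mul_comm]
  exact_mod_cast h

end MonomialTesting

open MonomialTesting in
theorem theorem1 (e : ℕ) :
    ∃ (P : Program) (c : ℕ), ∀ (p : ℕ), p.Prime → ∀ (n k : ℕ) (C : Circuit n),
      (C.poly (ZMod p)).totalDegree = k →
      ∀ T : ℕ, T = c * (n + k + C.size + p) ^ c * p ^ k →
        (∀ r : Fin T → Bool, ∃ b : Bool,
          P.AnswersWithin (encodeInput p k C) (extend r) T b) ∧
        1 - 1 / ((n : ℝ) + k + C.size + 2) ^ e ≤
          coinProb T (fun r => ∃ b : Bool,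
            P.AnswersWithin (encodeInput p k C) (extend r) T b ∧
              (b = true ↔ HasMonomial p k (C.poly (ZMod p)))) := by
  refine ⟨testProgram e, timeConstant e, fun p hp n k C hk T hT => ?_⟩
  classical
  have : Fact p.Prime := ⟨hp⟩
  set d := (e + 1) * (n + k + C.size + 2) with hd
  have hans : ∀ r : Fin T → Bool, (testProgram e).AnswersWithin (encodeInput p k C) (extend r) T
      (decide (coinSum p k d C (extend r) ≠ 0)) := by
    intro r
    obtain ⟨t, τ, hex, ht, hτ⟩ := exists_exec e p n k hp C (extend r)
    refine ⟨t, τ, hex, hT ▸ ht, hτ.trans ?_⟩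
    rw [if_congr (exists_partialSum_ne_zero_iff hk.le) rfl rfl]
    by_cases h : coinSum p k d C (extend r) = 0 <;> simp [← hd, h]
  refine ⟨fun r => ⟨_, hans r⟩, ?_⟩
  by_cases hmon : HasMonomial p k (C.poly (ZMod p))
  -- The coins that determine the matrix must be genuine ones, not part of the constant tail added
  -- by `extend`.
  · have hcoins : n * k * d ≤ T := by
      have hX : 1 ≤ n + k + C.size + p := by have := hp.two_le; omega
      calc n * k * d ≤ (n + k + C.size + p) ^ (e + 3) := (parameter_bounds e n k C.size p hp.two_le).2.2.2.2
        _ ≤ (n + k + C.size + p) ^ timeConstant e :=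
          Nat.pow_le_pow_right hX (by unfold timeConstant; omega)
        _ ≤ timeConstant e * (n + k + C.size + p) ^ timeConstant e :=
          Nat.le_mul_of_pos_left _ (by unfold timeConstant; omega)
        _ ≤ T := hT ▸ Nat.le_mul_of_pos_right _ (pow_pos hp.pos k)
    calc 1 - 1 / ((n : ℝ) + k + C.size + 2) ^ e ≤ 1 - (k : ℝ) / 2 ^ d :=
          sub_le_sub_left (div_two_pow_le e n k C.size) 1
      _ ≤ _ := coinProb_alternatingSum_ne_zero _ hk.le hmon d T hcoins
      _ ≤ _ := coinProb_mono fun r hr => ⟨_, hans r, iff_of_true (decide_eq_true hr) hmon⟩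
  -- Without a `p`-monomial of degree `k` the answer is correct for every outcome, so the
  -- probability is `1`.
  · calc 1 - 1 / ((n : ℝ) + k + C.size + 2) ^ e ≤ 1 := sub_le_self _ (by positivity)
      _ = _ := (coinProb_true T).symm
      _ ≤ _ := coinProb_mono fun r _ => ⟨_, hans r, by
        simp [hmon, coinSum_eq_zero hp hk.le hmon]⟩
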